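/- Let $\Omega\subseteq\mathbb R^2$ be a bounded open set with real-analytic boundary, let $z:\mathbb R/\mathbb Z\to\partial\Omega$ be a real-analytic orientation-preserving diffeomorphism ($\partial\Omega$ being oriented with $\Omega$ on its left), and let $\lambda\in(0,1)$. Write $$\ell_\lambda^{\pm}(x_1,x_2)=\pm\frac{x_1}{\lambda}+\frac{x_2}{\sqrt{1-\lambda^2}},\qquad L_\lambda^{\pm}=\tfrac12\left(\pm\lambda\,\partial_{x_1}+\sqrt{1-\lambda^2}\,\partial_{x_2}\right),$$ and extend $\ell_\lambda^\pm$ to $\mathbb C^2$ by $\mathbb C$-linearity. Assume that $\Omega$ is $\lambda$-simple, i.e. the restrictions of $\ell_\lambda^+$ and of $\ell_\lambda^-$ to $\partial\Omega$ each have exactly two critical points, which are non-degenerate. Let $\gamma_\lambda^\pm:\partial\Omega\to\partial\Omega$ be the involutions determined by $(x+\ker\ell_\lambda^\pm)\cap\partial\Omega=\{x,\gamma_\lambda^\pm(x)\}$. Let $X$ be a real-analytic vector field on $\partial\Omega$ such that the vector fields $$Y_\pm(x)=X(x)-\mathrm d\gamma_\lambda^\pm(\gamma_\lambda^\pm(x))\cdot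 X(\gamma_\lambda^\pm(x))$$ on $\partial\Omega$ do not vanish and are respectively negatively and positively oriented. Let $\Phi^X_t$ be the flow of $X$ on $\partial\Omega\subseteq\mathbb C^2$, extended holomorphically to small complex times $t$. Then there is $\tau_0>0$ such that $\Phi^X_\zeta(x)$ is defined and holomorphic in $\zeta$ for $|\zeta|<\tau_0$ and every $x\in\partial\Omega$, and the map $\Xi(\tau,x)=\Phi^X_{i\tau}(x)$, $(\tau,x)\in(-\tau_0,\tau_0)\times\partial\Omega$, has an extension $\Xi$ to $(-\tau_0,\tau_0)\times\overline\Omega$ with values in $\mathbb C^2$, real-analytic (on a neighbourhood of this set in $\mathbb R\times\mathbb R^2$), such that (i) $\Xi(0,x)=x$ for every $x\in\overline\Omega$; (ii) for every $x\in\overline\Omega$ and both choices of sign, $$\ell_\lambda^{\pm}\left(\frac{\partial L_\lambda^{\mp}\Xi}{\partial\tau}(0,x)\right)\in i\,\mathbb R_+^*,$$ where $L_\lambda^\mp$ acts on the variable $x$ with $\tau$ frozen and $\mathbb R_+^*=(0,\infty)$. -/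

import Mathlib

open Set Filter Topology

noncomputable section

namespace InternalWaves

/-- The linear form `ℓ_λ^±(x₁, x₂) = ± x₁ / λ + x₂ / √(1 - λ²)` on `ℝ²`.
The sign `±` is encoded by `s = 1` or `s = -1`. -/
def ell (s lam : ℝ) (x : ℝ × ℝ) : ℝ :=
  s * x.1 / lam + x.2 / Real.sqrt (1 - lam ^ 2)

/-- The `ℂ`-linear extension of `ell s lam` to `ℂ²`. -/
def ellC (s lam : ℝ) (x : ℂ × ℂ) : ℂ :=
  (s : ℂ) * x.1 / (lam : ℂ) + x.2 / (Real.sqrt (1 - lam ^ 2) : ℂ)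

/-- The vector `L_λ^± = (± λ, √(1 - λ²)) / 2`, identified with the constant coefficient
operator `(± λ ∂₁ + √(1 - λ²) ∂₂) / 2`. -/
def vecL (s lam : ℝ) : ℝ × ℝ :=
  (s * lam / 2, Real.sqrt (1 - lam ^ 2) / 2)

/-- The inclusion `ℝ² ⊆ ℂ²`. -/
def toC2 (x : ℝ × ℝ) : ℂ × ℂ := ((x.1 : ℂ), (x.2 : ℂ))

/-- Rotation by `+π/2`. -/
def rotJ (v : ℝ × ℝ) : ℝ × ℝ := (-v.2, v.1)

/-- `Ω` has real-analytic boundary: near each boundary point, `Ω` is the sublevel set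
`{φ < 0}` of a real-analytic function `φ` with nonzero differential. -/
def HasAnalyticBoundary (Ω : Set (ℝ × ℝ)) : Prop :=
  ∀ x ∈ frontier Ω, ∃ φ : ℝ × ℝ → ℝ,
    AnalyticAt ℝ φ x ∧ φ x = 0 ∧ fderiv ℝ φ x ≠ 0 ∧ ∀ᶠ y in 𝓝 x, (y ∈ Ω ↔ φ y < 0)

/-- `z` (a `1`-periodic function on `ℝ`, i.e. a function on `ℝ/ℤ`) is an orientation preserving
real-analytic diffeomorphism from `ℝ/ℤ` onto `∂Ω`. The boundary is oriented in the usual way: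
`Ω` lies on the left of the curve. -/
structure IsDirectParametrization (Ω : Set (ℝ × ℝ)) (z : ℝ → ℝ × ℝ) : Prop where
  analytic : ∀ θ, AnalyticAt ℝ z θ
  periodic : Function.Periodic z 1
  injOn : InjOn z (Ico 0 1)
  range_eq : range z = frontier Ω
  deriv_ne_zero : ∀ θ, deriv z θ ≠ 0
  direct : ∀ θ, ∀ᶠ ε : ℝ in 𝓝[>] 0, z θ + ε • rotJ (deriv z θ) ∈ Ω

/-- `λ`-simplicity: each of the restrictions of `ℓ_λ^+` and `ℓ_λ^-` to the boundary has exactly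
two critical points, and they are nondegenerate (everything is read in the coordinate `z`). -/
def IsLambdaSimple (z : ℝ → ℝ × ℝ) (lam : ℝ) : Prop :=
  ∀ s ∈ ({1, -1} : Set ℝ),
    {θ ∈ Ico (0 : ℝ) 1 | deriv (fun t => ell s lam (z t)) θ = 0}.ncard = 2 ∧
    ∀ θ, deriv (fun t => ell s lam (z t)) θ = 0 →
      deriv (deriv (fun t => ell s lam (z t))) θ ≠ 0

open Classical in
/-- The involution `γ_λ^±` of `∂Ω`: the point of `∂Ω` other than `x` on the line
`x + ker ℓ_λ^±`, or `x` itself if there is no such point. For a `λ`-simple domain one has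
`(x + ker ℓ_λ^±) ∩ ∂Ω = {x, γ_λ^±(x)}`, which determines `γ_λ^±`. -/
def gam (Ω : Set (ℝ × ℝ)) (s lam : ℝ) (x : ℝ × ℝ) : ℝ × ℝ :=
  if h : ∃ y ∈ frontier Ω, ell s lam y = ell s lam x ∧ y ≠ x then h.choose else x

open Classical in
/-- The differential `dg(y) · v` of a map `g` defined on the curve parametrized by `z`, at a point
`y` of the curve, applied to a tangent vector `v`: if `y = z(θ)` and `v = c z'(θ)`, it is
`c (g ∘ z)'(θ)`. -/
def curveDifferential (z : ℝ → ℝ × ℝ) (g : ℝ × ℝ → ℝ × ℝ) (y v : ℝ × ℝ) : ℝ × ℝ :=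
  if h : ∃ p : ℝ × ℝ, z p.1 = y ∧ p.2 • deriv z p.1 = v then
    h.choose.2 • deriv (fun t => g (z t)) h.choose.1
  else 0

/-- `X` is a real-analytic vector field on (tangent to) the curve parametrized by `z`. Only the
values of `X` on the curve matter. -/
def IsAnalyticTangentField (z : ℝ → ℝ × ℝ) (X : ℝ × ℝ → ℝ × ℝ) : Prop :=
  ∃ h : ℝ → ℝ, (∀ θ, AnalyticAt ℝ h θ) ∧ ∀ θ, X (z θ) = h θ • deriv z θ

/-- The vector field `Y_±(x) = X(x) - dγ_λ^±(γ_λ^±(x)) · X(γ_λ^±(x))`. -/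
def fieldY (Ω : Set (ℝ × ℝ)) (z : ℝ → ℝ × ℝ) (lam : ℝ) (X : ℝ × ℝ → ℝ × ℝ) (s : ℝ)
    (x : ℝ × ℝ) : ℝ × ℝ :=
  X x - curveDifferential z (gam Ω s lam) (gam Ω s lam x) (X (gam Ω s lam x))

/-- `X` is a real-analytic vector field on `∂Ω` such that `Y_+` and `Y_-` do not vanish and are
respectively negatively and positively oriented. -/
structure IsEscapeField (Ω : Set (ℝ × ℝ)) (z : ℝ → ℝ × ℝ) (lam : ℝ)
    (X : ℝ × ℝ → ℝ × ℝ) : Prop where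
  analytic : IsAnalyticTangentField z X
  plus_negative : ∀ θ, ∃ c : ℝ, c < 0 ∧ fieldY Ω z lam X 1 (z θ) = c • deriv z θ
  minus_positive : ∀ θ, ∃ c : ℝ, 0 < c ∧ fieldY Ω z lam X (-1) (z θ) = c • deriv z θ

/-- `Φ` is the (complete) flow on `S` of the vector field `X`: `Φ t x = Φ_t^X(x)`. -/
def IsFlowOn (S : Set (ℝ × ℝ)) (X : ℝ × ℝ → ℝ × ℝ) (Φ : ℝ → ℝ × ℝ → ℝ × ℝ) : Prop :=
  ∀ x ∈ S, Φ 0 x = x ∧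
    ∀ t, Φ t x ∈ S ∧ HasDerivAt (fun u => Φ u x) (X (Φ t x)) t

/-- `Ψ` is the flow of `X` on `S` in complex time `|ζ| < r`: for each `x ∈ S` the map
`ζ ↦ Ψ ζ x = Φ_ζ^X(x)` is the holomorphic extension to the disc of radius `r` of the real-time
flow `t ↦ Φ_t^X(x)`. -/
structure IsComplexTimeFlow (S : Set (ℝ × ℝ)) (X : ℝ × ℝ → ℝ × ℝ) (r : ℝ)
    (Ψ : ℂ → ℝ × ℝ → ℂ × ℂ) : Prop where
  holomorphic : ∀ x ∈ S, DifferentiableOn ℂ (fun ζ => Ψ ζ x) (Metric.ball 0 r)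
  real_time : ∃ Φ : ℝ → ℝ × ℝ → ℝ × ℝ, IsFlowOn S X Φ ∧
    ∀ x ∈ S, ∀ t ∈ Ioo (-r) r, Ψ (t : ℂ) x = toC2 (Φ t x)

/-- The mixed derivative `∂_τ (L Ξ)(0, x)`, where the constant vector field `L` acts on the
variable `x` with `τ` frozen. -/
def mixedDeriv (Ξ : ℝ × (ℝ × ℝ) → ℂ × ℂ) (L x : ℝ × ℝ) : ℂ × ℂ :=
  deriv (fun τ : ℝ => fderiv ℝ (fun y : ℝ × ℝ => Ξ (τ, y)) x L) 0

end InternalWaves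

end

/-! In the coordinates `ℓ^+`, `ℓ^-` the two components of the deformation can be extended
separately. Fix a sign `s` and put `y = ℓ^s ∘ z`, `g = ℓ^{-s} ∘ z`. The component `ℓ^s` of the flow
is a function `F` on the circle; it is extended to the closed domain by the function that is affine
in `ℓ^{-s}` on each chord `ℓ^s = c` and takes the right values at the two ends. Thus `F = a(y) + g
b(y)` and `G(x) = a(ℓ^s x) + ℓ^{-s}(x) b(ℓ^s x)`.

All small times are treated at once: `F` takes values in a Banach space of rescaled Taylor
coefficients in time. With `X = h z'`, these come from the Lie series `∑ ζ^n (h d/dθ)^n f / n!`.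
Cauchy estimates make `F` analytic into `BSeq` with one scale `K` for the whole circle, and
evaluation at `ζ = iτ` is linear in `G` and analytic in `τ`.

The coefficients `a`, `b` are analytic up to the ends of the range of `y` (`exists_interp`). At an
interior value they are divided differences between the two analytic branches of the inverse of `y`.
At an extreme value a Morse coordinate turns `y` into a square, and `b` is the quotient of the odd
parts of `F` and `g`.

For (i), the coefficient of order zero of `F` is `y`, whose interpolation has `a = c`, `b = 0`. For
(ii), the quantity is `i` times the slope of the interpolation of `h y'`. On a chord with ends `p`,
`q`, the identity `ℓ^s ∘ γ^s = ℓ^s` gives `(h y')(p) - (h y')(q) = ℓ^s(Y_s(z p))`, and the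
orientation of the boundary (`sign_deriv_ell`) makes this positive when `g p > g q`. At a critical
point the slope is nonnegative by continuity, and differentiating the interpolation identity gives
`h y'' = g' b` with `h ≠ 0` (`interp_slope_pos`). -/

noncomputable section

namespace InternalWaves

/-! ### Banach-valued power series with geometrically bounded coefficients -/

section PowerSeries

variable {𝕜 E : Type*} [RCLike 𝕜] [NormedAddCommGroup E] [NormedSpace 𝕜 E] [CompleteSpace E]

theorem summable_pow_smul {c : ℕ → E} {C r : ℝ} (hc : ∀ n, ‖c n‖ * r ^ n ≤ C) {x : 𝕜}
    (hx : ‖x‖ < r) : Summable fun n => x ^ n • c n := by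
  have hr : 0 < r := (norm_nonneg x).trans_lt hx
  have hg : Summable fun n : ℕ => C * (‖x‖ / r) ^ n :=
    (summable_geometric_of_lt_one (by positivity) ((div_lt_one hr).2 hx)).mul_left C
  refine Summable.of_norm_bounded hg fun n => ?_
  rw [norm_smul, norm_pow, div_pow]
  have h1 : 0 ≤ ‖x‖ ^ n / r ^ n := by positivity
  calc ‖x‖ ^ n * ‖c n‖ = (‖c n‖ * r ^ n) * (‖x‖ ^ n / r ^ n) := by field_simp
    _ ≤ C * (‖x‖ ^ n / r ^ n) := mul_le_mul_of_nonneg_right (hc n) h1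

/-- Vector-valued coefficients over a general field are needed: it serves for series of operators,
of elements of `BSeq` and of scalars, over `ℝ` and over `ℂ`. -/
theorem analyticOnNhd_tsum_pow_smul {c : ℕ → E} {C r : ℝ} (hr : 0 < r)
    (hc : ∀ n, ‖c n‖ * r ^ n ≤ C) :
    AnalyticOnNhd 𝕜 (fun x : 𝕜 => ∑' n, x ^ n • c n) (Metric.ball 0 r) := by
  let p : FormalMultilinearSeries 𝕜 𝕜 E := fun n => ContinuousMultilinearMap.mkPiRing 𝕜 (Fin n) (c n)
  have hp : ∀ n, ‖p n‖ = ‖c n‖ := fun n => by simp [p]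
  let r' : NNReal := ⟨r, hr.le⟩
  have hrad : (r' : ENNReal) ≤ p.radius :=
    p.le_radius_of_bound C fun n => by rw [hp]; exact hc n
  have hpos : 0 < p.radius := lt_of_lt_of_le (by
    rw [ENNReal.coe_pos]; exact hr) hrad
  have hsum : (fun x : 𝕜 => ∑' n, x ^ n • c n) = p.sum := by
    funext x
    simp [FormalMultilinearSeries.sum, p]
  rw [hsum]
  refine (p.hasFPowerSeriesOnBall hpos).analyticOnNhd.mono ?_
  intro x hx
  refine Metric.eball_subset_eball hrad ?_
  rw [Metric.mem_eball, edist_nndist, ENNReal.coe_lt_coe]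
  rw [Metric.mem_ball] at hx
  exact_mod_cast hx

end PowerSeries

/-! ### Bounded sequences as Taylor coefficients, and their evaluation -/

/-- The Banach space of bounded complex sequences, carrying rescaled Taylor coefficients. -/
abbrev BSeq : Type := lp (fun _ : ℕ => ℂ) ⊤

/-- The `n`-th coordinate on `BSeq`. -/
def coord (n : ℕ) : BSeq →L[ℂ] ℂ := lp.evalCLM ℂ (fun _ : ℕ => ℂ) ⊤ n

@[simp] theorem coord_apply (n : ℕ) (c : BSeq) : coord n c = c n := rfl

theorem norm_coord_le (n : ℕ) : ‖coord n‖ ≤ 1 :=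
  ContinuousLinearMap.opNorm_le_bound _ zero_le_one fun c => by
    rw [one_mul]; exact lp.norm_apply_le_norm (by simp) c n

/-- Summation of the power series with coefficients `K ^ n * c n` at `ζ`. -/
def evalSeries (K : ℝ) (ζ : ℂ) : BSeq →L[ℂ] ℂ := ∑' n, ((K : ℂ) * ζ) ^ n • coord n

theorem norm_mul_lt {K : ℝ} (hK : 0 < K) {ζ : ℂ} (hζ : ‖ζ‖ < 1 / K) : ‖(K : ℂ) * ζ‖ < 1 := by
  rw [norm_mul, Complex.norm_real, Real.norm_of_nonneg hK.le]
  rwa [lt_div_iff₀ hK, mul_comm] at hζ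

theorem hasSum_evalSeries {K : ℝ} (hK : 0 < K) (c : BSeq) {ζ : ℂ} (hζ : ‖ζ‖ < 1 / K) :
    HasSum (fun n => (K * ζ) ^ n * c n) (evalSeries K ζ c) := by
  have hs : Summable fun n => ((K : ℂ) * ζ) ^ n • coord n :=
    summable_pow_smul (C := 1) (r := 1) (fun n => by simpa using norm_coord_le n)
      (norm_mul_lt hK hζ)
  exact hs.hasSum.mapL (ContinuousLinearMap.apply ℂ ℂ c)

/-- Analyticity holds in operator norm, because the coordinates have norm at most one. Joint
analyticity in the time and in the sequence then follows from bilinearity of evaluation. -/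
theorem analyticOnNhd_evalSeries {K : ℝ} (hK : 0 < K) :
    AnalyticOnNhd ℂ (evalSeries K) (Metric.ball 0 (1 / K)) := by
  intro ζ hζ
  have h1 := analyticOnNhd_tsum_pow_smul (𝕜 := ℂ) (c := coord) (C := 1) one_pos
    (fun n => by simpa using norm_coord_le n)
  have h2 : AnalyticAt ℂ (fun ζ : ℂ => (K : ℂ) * ζ) ζ := by fun_prop
  exact AnalyticAt.comp (g := fun x : ℂ => ∑' n, x ^ n • coord n) (f := fun ζ : ℂ => (K : ℂ) * ζ)
    (h1 _ (by simpa using norm_mul_lt hK (by simpa using hζ))) h2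

theorem evalSeries_zero {K : ℝ} (hK : 0 < K) (c : BSeq) : evalSeries K 0 c = c 0 := by
  have h := hasSum_evalSeries hK c (ζ := 0) (by simpa using hK)
  refine h.unique ?_
  convert hasSum_single (f := fun n => ((K : ℂ) * 0) ^ n * c n) 0 ?_ using 1
  · simp
  · intro n hn
    simp [hn]

theorem hasDerivAt_evalSeries_zero {K : ℝ} (hK : 0 < K) :
    HasDerivAt (evalSeries K) ((K : ℂ) • coord 1) 0 := by
  have han := (analyticOnNhd_evalSeries hK 0 (by simpa using hK)).differentiableAt.hasDerivAt
  suffices h : deriv (evalSeries K) 0 = (K : ℂ) • coord 1 by rwa [h] at han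
  ext c
  have hc : HasDerivAt (fun ζ => evalSeries K ζ c) (deriv (evalSeries K) 0 c) 0 := by
    have := han.clm_apply (hasDerivAt_const (0 : ℂ) c)
    simpa using this
  let d : ℕ → ℂ := fun n => c (n + 1)
  have hd : ∀ n, ‖d n‖ * (1 : ℝ) ^ n ≤ ‖c‖ := fun n => by
    simpa [d] using lp.norm_apply_le_norm (by simp) c (n + 1)
  let q : ℂ → ℂ := fun x => ∑' n, x ^ n • d n
  have hq : ContinuousAt q 0 :=
    (analyticOnNhd_tsum_pow_smul (𝕜 := ℂ) one_pos hd 0 (by simp)).continuousAt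
  have hq0 : q 0 = c 1 := by
    have : q 0 = (0 : ℂ) ^ 0 • d 0 := tsum_eq_single 0 fun n hn => by simp [hn]
    simpa [d] using this
  have hrep : ∀ᶠ ζ : ℂ in 𝓝 0, evalSeries K ζ c = c 0 + ζ * (K * q (K * ζ)) := by
    filter_upwards [Metric.ball_mem_nhds (0 : ℂ) (by positivity : (0 : ℝ) < 1 / K)] with ζ hζ
    have hζ' : ‖ζ‖ < 1 / K := by simpa using hζ
    have hs := hasSum_evalSeries hK c hζ'
    rw [← hs.tsum_eq, hs.summable.tsum_eq_zero_add]
    have : ∀ n, ((K : ℂ) * ζ) ^ (n + 1) * c (n + 1) = (K * ζ) * ((K * ζ) ^ n • d n) := fun n => by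
      simp only [d, smul_eq_mul]; ring
    simp only [this, tsum_mul_left, q]
    ring
  -- The slope at `0` is exactly `K * q (K * ζ)`, so continuity of `q` at `0` is enough.
  have hder : HasDerivAt (fun ζ => c 0 + ζ * (K * q (K * ζ))) (K * c 1) 0 := by
    rw [hasDerivAt_iff_tendsto_slope]
    have hlim : Tendsto (fun ζ : ℂ => (K : ℂ) * q (K * ζ)) (𝓝[≠] 0) (𝓝 (K * c 1)) := by
      have hcc : ContinuousAt (fun ζ : ℂ => (K : ℂ) * q (K * ζ)) 0 := by
        have h1 : ContinuousAt (fun ζ : ℂ => q (K * ζ)) 0 :=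
          ContinuousAt.comp (g := q) (by simpa using hq) (by fun_prop)
        exact continuousAt_const.mul h1
      have := hcc.tendsto.mono_left (nhdsWithin_le_nhds (s := {0}ᶜ))
      simpa [hq0] using this
    refine hlim.congr' ?_
    filter_upwards [self_mem_nhdsWithin] with ζ hζ
    have hζ0 : ζ ≠ 0 := hζ
    simp [slope_def_field, hζ0]
  have := hc.unique (hder.congr_of_eventuallyEq hrep)
  simpa using this

/-- A uniformly bounded sequence of holomorphic functions is holomorphic as a `BSeq`-valued
function. -/
theorem analyticAt_bseq {φ : ℕ → ℂ → ℂ} {w₀ : ℂ} {R C : ℝ} (hR : 0 < R)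
    (hφ : ∀ n, DifferentiableOn ℂ (φ n) (Metric.ball w₀ R))
    (hC : ∀ n, ∀ w ∈ Metric.ball w₀ R, ‖φ n w‖ ≤ C) {F : ℂ → BSeq}
    (hF : ∀ w ∈ Metric.ball w₀ R, ∀ n, F w n = φ n w) : AnalyticAt ℂ F w₀ := by
  set ρ := R / 2 with hρ
  have hρ0 : 0 < ρ := by positivity
  have hC0 : 0 ≤ C := (norm_nonneg _).trans (hC 0 w₀ (Metric.mem_ball_self hR))
  have hcl : Metric.closedBall w₀ ρ ⊆ Metric.ball w₀ R :=
    Metric.closedBall_subset_ball (by linarith)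
  -- Taylor coefficients of all the `φ n` at `w₀`. Cauchy's inequality bounds them uniformly in `n`,
  -- so for each order `k` they form one element of `BSeq`, and the Taylor series converges in norm.
  let a : ℕ → ℕ → ℂ := fun k n => (k.factorial : ℂ)⁻¹ * iteratedDeriv k (φ n) w₀
  have ha : ∀ k n, ‖a k n‖ ≤ C / ρ ^ k := fun k n => by
    have hd : DiffContOnCl ℂ (φ n) (Metric.ball w₀ ρ) :=
      ((hφ n).mono (Metric.closure_ball_subset_closedBall.trans hcl)).diffContOnCl
    have := Complex.norm_iteratedDeriv_le_of_forall_mem_sphere_norm_le k hρ0 hd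
      (fun z hz => hC n z (hcl (Metric.sphere_subset_closedBall hz)))
    simp only [a, norm_mul, norm_inv, Complex.norm_natCast]
    rw [inv_mul_le_iff₀ (by positivity)]
    rwa [mul_div_assoc] at this
  let A : ℕ → BSeq := fun k => ⟨a k, memℓp_infty ⟨C / ρ ^ k, by
    rintro _ ⟨n, rfl⟩
    exact ha k n⟩⟩
  have hA : ∀ k, ‖A k‖ * ρ ^ k ≤ C := fun k => by
    have : ‖A k‖ ≤ C / ρ ^ k := lp.norm_le_of_forall_le (by positivity) (ha k)
    rwa [le_div_iff₀ (by positivity)] at this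
  have hsum := analyticOnNhd_tsum_pow_smul (𝕜 := ℂ) hρ0 hA 0 (Metric.mem_ball_self hρ0)
  have hcomp : AnalyticAt ℂ (fun w : ℂ => ∑' k, (w - w₀) ^ k • A k) w₀ :=
    AnalyticAt.comp (g := fun x : ℂ => ∑' n, x ^ n • A n) (f := fun w : ℂ => w - w₀)
      (by simpa using hsum) (by fun_prop)
  refine hcomp.congr ?_
  filter_upwards [Metric.ball_mem_nhds w₀ hρ0] with w hw
  have hw' : ‖w - w₀‖ < ρ := by rwa [Metric.mem_ball, dist_eq_norm] at hw
  have hs := (summable_pow_smul hA hw').hasSum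
  ext n
  have hn := hs.mapL (coord n)
  have hwR : w ∈ Metric.ball w₀ R := hcl (Metric.ball_subset_closedBall hw)
  have ht := Complex.hasSum_taylorSeries_on_ball (hφ n) hwR
  have : (fun k => coord n ((w - w₀) ^ k • A k)) =
      fun k => (k.factorial : ℂ)⁻¹ • (w - w₀) ^ k • iteratedDeriv k (φ n) w₀ := by
    funext k
    simp only [map_smul, coord_apply, A, a, smul_eq_mul]
    ring
  rw [this] at hn
  rw [hF w hwR n]
  exact hn.unique ht

/-! ### Cauchy estimates for Lie series -/

/-- A real-analytic function extends holomorphically, with a bound, near each real point. -/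
theorem exists_complexification {f : ℝ → ℝ} {θ₀ : ℝ} (hf : AnalyticAt ℝ f θ₀) :
    ∃ R > 0, ∃ C, ∃ fC : ℂ → ℂ, DifferentiableOn ℂ fC (Metric.ball (θ₀ : ℂ) R) ∧
      (∀ w ∈ Metric.ball (θ₀ : ℂ) R, ‖fC w‖ ≤ C) ∧
      ∀ x : ℝ, |x - θ₀| < R → fC x = f x := by
  obtain ⟨p, r, hp⟩ := hf
  obtain ⟨r', hr'0, hr'⟩ := ENNReal.lt_iff_exists_nnreal_btwn.1 hp.r_pos
  have hr0 : (0 : ℝ) < r' := by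
    have := hr'0
    rw [ENNReal.coe_pos] at this
    exact_mod_cast this
  obtain ⟨C, hC0, hC⟩ := p.norm_mul_pow_le_of_lt_radius (hr'.trans_le hp.r_le)
  let c : ℕ → ℂ := fun n => ((p.coeff n : ℝ) : ℂ)
  have hc : ∀ n, ‖c n‖ * (r' : ℝ) ^ n ≤ C := fun n => by
    have h1 : ‖c n‖ = ‖p n‖ := by
      simp only [c, Complex.norm_real]
      exact p.norm_apply_eq_norm_coef.symm
    rw [h1]; exact hC n
  have han := analyticOnNhd_tsum_pow_smul (𝕜 := ℂ) hr0 hc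
  let g : ℂ → ℂ := fun w => ∑' n, (w - θ₀) ^ n • c n
  have hg : DifferentiableOn ℂ g (Metric.ball (θ₀ : ℂ) r') := by
    have := han.differentiableOn.comp (f := fun w : ℂ => w - θ₀) (s := Metric.ball (θ₀ : ℂ) r')
      (by fun_prop) (fun w hw => by simpa [dist_eq_norm] using hw)
    exact this
  -- The radius is halved so that the extension is bounded by compactness.
  have hcl : Metric.closedBall (θ₀ : ℂ) (r' / 2) ⊆ Metric.ball (θ₀ : ℂ) r' :=
    Metric.closedBall_subset_ball (by linarith)
  obtain ⟨B, hB⟩ := (isCompact_closedBall (θ₀ : ℂ) (r' / 2 : ℝ)).exists_bound_of_continuousOn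
    (hg.continuousOn.mono hcl)
  refine ⟨r' / 2, by positivity, B, g, hg.mono (Metric.ball_subset_closedBall.trans hcl),
    fun w hw => hB w (Metric.ball_subset_closedBall hw), fun x hx => ?_⟩
  have hx' : x - θ₀ ∈ Metric.eball (0 : ℝ) r := by
    refine Metric.eball_subset_eball hr'.le ?_
    rw [Metric.mem_eball, edist_nndist, ENNReal.coe_lt_coe]
    have : dist (x - θ₀) 0 < r' := by
      rw [dist_zero_right, Real.norm_eq_abs]; linarith
    exact_mod_cast this
  have hs := hp.hasSum hx'
  rw [add_sub_cancel] at hs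
  have hs2 := Complex.hasSum_ofReal.2 hs
  rw [← hs2.tsum_eq]
  refine tsum_congr fun n => ?_
  rw [FormalMultilinearSeries.apply_eq_pow_smul_coeff]
  simp [c]

/-- The iterated Lie derivatives `(h d/dx)^n f`. -/
def lieIter {𝕜 : Type*} [NontriviallyNormedField 𝕜] (h f : 𝕜 → 𝕜) : ℕ → 𝕜 → 𝕜
  | 0 => f
  | n + 1 => fun x => h x * deriv (lieIter h f n) x

theorem analyticAt_lieIter {h f : ℝ → ℝ} (hh : ∀ x, AnalyticAt ℝ h x)
    (hf : ∀ x, AnalyticAt ℝ f x) (n : ℕ) (x : ℝ) : AnalyticAt ℝ (lieIter h f n) x := by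
  induction n generalizing x with
  | zero => exact hf x
  | succ n ih => exact (hh x).mul (ih x).deriv

theorem deriv_periodic {f : ℝ → ℝ} {c : ℝ} (hf : Function.Periodic f c) :
    Function.Periodic (deriv f) c := fun x => by
  rw [← deriv_comp_add_const]
  exact congrArg (fun g => deriv g x) (funext hf)

theorem lieIter_periodic {h f : ℝ → ℝ} (hh : Function.Periodic h 1)
    (hf : Function.Periodic f 1) (n : ℕ) : Function.Periodic (lieIter h f n) 1 := by
  induction n with
  | zero => exact hf
  | succ n ih =>
    intro x
    simp only [lieIter]
    rw [hh x, deriv_periodic ih x]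

theorem lieIter_succ' {𝕜 : Type*} [NontriviallyNormedField 𝕜] (h f : 𝕜 → 𝕜) (n : ℕ) :
    lieIter h f (n + 1) = lieIter h (lieIter h f 1) n := by
  induction n with
  | zero => rfl
  | succ n ih => funext x; rw [lieIter, ih]; rfl

theorem differentiableOn_lieIter {h f : ℂ → ℂ} {U : Set ℂ} (hU : IsOpen U)
    (hh : DifferentiableOn ℂ h U) (hf : DifferentiableOn ℂ f U) (n : ℕ) :
    DifferentiableOn ℂ (lieIter h f n) U := by
  induction n with
  | zero => exact hf
  | succ n ih => exact hh.mul (ih.deriv hU)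

/-- Each Lie derivative costs a factor `M / η`, by Cauchy's inequality on circles of radius `η`, and
shrinks the disc by `η`. -/
theorem norm_lieIter_le {h f : ℂ → ℂ} {c : ℂ} {R M C η : ℝ} (hη : 0 < η)
    (hh : DifferentiableOn ℂ h (Metric.ball c R)) (hf : DifferentiableOn ℂ f (Metric.ball c R))
    (hM : ∀ w ∈ Metric.ball c R, ‖h w‖ ≤ M) (hC : ∀ w ∈ Metric.ball c R, ‖f w‖ ≤ C)
    (n : ℕ) : ∀ w ∈ Metric.ball c (R - n * η), ‖lieIter h f n w‖ ≤ C * (M / η) ^ n := by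
  induction n with
  | zero => simpa [lieIter] using hC
  | succ n ih =>
    intro w hw
    have hw' : dist w c < R - (n + 1) * η := by simpa using hw
    have hwR : w ∈ Metric.ball c R := by
      rw [Metric.mem_ball]
      have : 0 ≤ ((n : ℝ) + 1) * η := by positivity
      linarith
    have hsub : Metric.closedBall w η ⊆ Metric.ball c (R - n * η) := fun v hv => by
      rw [Metric.mem_closedBall] at hv
      rw [Metric.mem_ball]
      have := dist_triangle v w c
      linarith
    have hsub2 : Metric.ball c (R - n * η) ⊆ Metric.ball c R :=
      Metric.ball_subset_ball (by have : 0 ≤ (n : ℝ) * η := by positivity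
                                  linarith)
    have hd : DiffContOnCl ℂ (lieIter h f n) (Metric.ball w η) :=
      ((differentiableOn_lieIter Metric.isOpen_ball hh hf n).mono
        ((Metric.closure_ball_subset_closedBall.trans hsub).trans hsub2)).diffContOnCl
    have h1 := Complex.norm_deriv_le_of_forall_mem_sphere_norm_le hη hd
      (fun z hz => ih z (hsub (Metric.sphere_subset_closedBall hz)))
    have hM0 : 0 ≤ M := (norm_nonneg _).trans (hM w hwR)
    simp only [lieIter, norm_mul]
    calc ‖h w‖ * ‖deriv (lieIter h f n) w‖ ≤ M * (C * (M / η) ^ n / η) :=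
          mul_le_mul (hM w hwR) h1 (norm_nonneg _) hM0
      _ = C * (M / η) ^ (n + 1) := by rw [pow_succ]; ring

/-- Spending half of the radius on `n` derivatives means `η = R / (2n)`; the resulting `n ^ n` is
absorbed by `n ^ n ≤ n! e ^ n`. -/
theorem norm_lieIter_le_factorial {h f : ℂ → ℂ} {c : ℂ} {R M C : ℝ} (hR : 0 < R)
    (hh : DifferentiableOn ℂ h (Metric.ball c R)) (hf : DifferentiableOn ℂ f (Metric.ball c R))
    (hM : ∀ w ∈ Metric.ball c R, ‖h w‖ ≤ M) (hC : ∀ w ∈ Metric.ball c R, ‖f w‖ ≤ C)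
    (n : ℕ) : ∀ w ∈ Metric.ball c (R / 2),
      ‖lieIter h f n w‖ ≤ C * (n.factorial * (2 * M / R * Real.exp 1) ^ n) := by
  intro w hw
  have hcR : c ∈ Metric.ball c R := Metric.mem_ball_self hR
  have hC0 : 0 ≤ C := (norm_nonneg _).trans (hC c hcR)
  have hM0 : 0 ≤ M := (norm_nonneg _).trans (hM c hcR)
  rcases Nat.eq_zero_or_pos n with rfl | hn
  · simpa [lieIter] using hC w (Metric.ball_subset_ball (by linarith) hw)
  have hn' : (0 : ℝ) < n := by exact_mod_cast hn
  have h1 := norm_lieIter_le (η := R / (2 * n)) (by positivity) hh hf hM hC n w (by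
    have : R - n * (R / (2 * n)) = R / 2 := by field_simp; ring
    rwa [this])
  refine h1.trans (mul_le_mul_of_nonneg_left ?_ hC0)
  have h2 : (n : ℝ) ^ n ≤ n.factorial * Real.exp 1 ^ n := by
    have := Real.pow_div_factorial_le_exp (n : ℝ) hn'.le n
    rw [div_le_iff₀ (by positivity)] at this
    rw [← Real.exp_nat_mul, mul_one, mul_comm]
    exact this
  calc (M / (R / (2 * n))) ^ n = (2 * M / R) ^ n * (n : ℝ) ^ n := by
        rw [← mul_pow]; congr 1; field_simp
    _ ≤ (2 * M / R) ^ n * (n.factorial * Real.exp 1 ^ n) :=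
        mul_le_mul_of_nonneg_left h2 (by positivity)
    _ = n.factorial * (2 * M / R * Real.exp 1) ^ n := by rw [mul_pow]; ring

theorem lieIter_ofReal {h f : ℝ → ℝ} (hh : ∀ x, AnalyticAt ℝ h x)
    (hf : ∀ x, AnalyticAt ℝ f x) {hC fC : ℂ → ℂ} {θ₀ R : ℝ}
    (dh : DifferentiableOn ℂ hC (Metric.ball (θ₀ : ℂ) R))
    (df : DifferentiableOn ℂ fC (Metric.ball (θ₀ : ℂ) R))
    (eh : ∀ x : ℝ, |x - θ₀| < R → hC x = h x) (ef : ∀ x : ℝ, |x - θ₀| < R → fC x = f x)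
    (n : ℕ) : ∀ x : ℝ, |x - θ₀| < R → lieIter hC fC n x = lieIter h f n x := by
  induction n with
  | zero => exact ef
  | succ n ih =>
    intro x hx
    have hxb : (x : ℂ) ∈ Metric.ball (θ₀ : ℂ) R := by
      rw [Metric.mem_ball, dist_eq_norm, ← Complex.ofReal_sub, Complex.norm_real]
      exact hx
    have h1 := ((differentiableOn_lieIter Metric.isOpen_ball dh df n).differentiableAt
      (Metric.isOpen_ball.mem_nhds hxb)).hasDerivAt.comp_ofReal
    have h2 := (analyticAt_lieIter hh hf n x).differentiableAt.hasDerivAt.ofReal_comp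
    have hev : (fun y : ℝ => lieIter hC fC n y) =ᶠ[𝓝 x] fun y => ((lieIter h f n y : ℝ) : ℂ) := by
      have hop : IsOpen {y : ℝ | |y - θ₀| < R} := isOpen_lt (by fun_prop) (by fun_prop)
      filter_upwards [hop.mem_nhds hx] with y hy using ih y hy
    have h3 := h1.unique (h2.congr_of_eventuallyEq hev)
    simp only [lieIter]
    rw [h3, eh x hx]
    push_cast
    rfl

open Classical in
/-- A bounded sequence as an element of `BSeq`, and `0` for an unbounded one. -/
def toBSeq (c : ℕ → ℂ) : BSeq := if hc : Memℓp c ⊤ then ⟨c, hc⟩ else 0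

/-- The rescaled coefficients of the Lie series `∑ ζ^n (h d/dx)^n f / n!`. -/
def lieSeq (h f : ℝ → ℝ) (K θ : ℝ) : BSeq :=
  toBSeq fun n => ((lieIter h f n θ / (n.factorial * K ^ n) : ℝ) : ℂ)

/-- The iterates of the holomorphic extensions, divided by `n! K ^ n`, are uniformly bounded on a
complex disc, so `analyticAt_bseq` applies there; the real statement is its restriction. -/
theorem exists_lieSeq_local {h f : ℝ → ℝ} (hh : ∀ x, AnalyticAt ℝ h x)
    (hf : ∀ x, AnalyticAt ℝ f x) (θ₀ : ℝ) :
    ∃ K₀ > 0, ∃ R > 0, ∀ K ≥ K₀, ∀ θ, |θ - θ₀| < R →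
      (∀ n, lieSeq h f K θ n = ((lieIter h f n θ / (n.factorial * K ^ n) : ℝ) : ℂ)) ∧
      AnalyticAt ℝ (lieSeq h f K) θ := by
  obtain ⟨R₁, hR₁, M, hC, dh, bh, eh⟩ := exists_complexification (hh θ₀)
  obtain ⟨R₂, hR₂, C, fC, df, bf, ef⟩ := exists_complexification (hf θ₀)
  set R := min R₁ R₂ with hRdef
  have hR : 0 < R := lt_min hR₁ hR₂
  have s1 : Metric.ball (θ₀ : ℂ) R ⊆ Metric.ball (θ₀ : ℂ) R₁ :=
    Metric.ball_subset_ball (min_le_left _ _)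
  have s2 : Metric.ball (θ₀ : ℂ) R ⊆ Metric.ball (θ₀ : ℂ) R₂ :=
    Metric.ball_subset_ball (min_le_right _ _)
  replace dh := dh.mono s1
  replace df := df.mono s2
  replace bh := fun w hw => bh w (s1 hw)
  replace bf := fun w hw => bf w (s2 hw)
  replace eh := fun (x : ℝ) (hx : |x - θ₀| < R) => eh x (lt_of_lt_of_le hx (min_le_left _ _))
  replace ef := fun (x : ℝ) (hx : |x - θ₀| < R) => ef x (lt_of_lt_of_le hx (min_le_right _ _))
  have hcR : (θ₀ : ℂ) ∈ Metric.ball (θ₀ : ℂ) R := Metric.mem_ball_self hR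
  have hM0 : 0 ≤ M := (norm_nonneg _).trans (bh _ hcR)
  have hC0 : 0 ≤ C := (norm_nonneg _).trans (bf _ hcR)
  -- The growth rate from `norm_lieIter_le_factorial`; adding `1` keeps it positive when `M = 0`.
  refine ⟨2 * M / R * Real.exp 1 + 1, by positivity, R / 2, by positivity, fun K hK => ?_⟩
  have hKpos : 0 < K := lt_of_lt_of_le (by positivity) hK
  let φ : ℕ → ℂ → ℂ := fun n w => lieIter hC fC n w / (n.factorial * (K : ℂ) ^ n)
  have hφd : ∀ n, DifferentiableOn ℂ (φ n) (Metric.ball (θ₀ : ℂ) (R / 2)) := fun n =>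
    ((differentiableOn_lieIter Metric.isOpen_ball dh df n).mono
      (Metric.ball_subset_ball (by linarith))).div_const _
  have hφb : ∀ n, ∀ w ∈ Metric.ball (θ₀ : ℂ) (R / 2), ‖φ n w‖ ≤ C := fun n w hw => by
    have h1 := norm_lieIter_le_factorial hR dh df bh bf n w hw
    simp only [φ, norm_div, norm_mul, norm_pow, Complex.norm_natCast, Complex.norm_real,
      Real.norm_of_nonneg hKpos.le]
    rw [div_le_iff₀ (by positivity)]
    refine h1.trans (mul_le_mul_of_nonneg_left (mul_le_mul_of_nonneg_left ?_ (by positivity)) hC0)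
    exact pow_le_pow_left₀ (by positivity) (by linarith) n
  have hmem : ∀ w ∈ Metric.ball (θ₀ : ℂ) (R / 2), Memℓp (fun n => φ n w) ⊤ := fun w hw =>
    memℓp_infty ⟨C, by rintro _ ⟨n, rfl⟩; exact hφb n w hw⟩
  have hreal : ∀ θ : ℝ, |θ - θ₀| < R / 2 → (θ : ℂ) ∈ Metric.ball (θ₀ : ℂ) (R / 2) := fun θ hθ => by
    rw [Metric.mem_ball, dist_eq_norm, ← Complex.ofReal_sub, Complex.norm_real]
    exact hθ
  have hφr : ∀ θ : ℝ, |θ - θ₀| < R / 2 → ∀ n,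
      φ n θ = ((lieIter h f n θ / (n.factorial * K ^ n) : ℝ) : ℂ) := fun θ hθ n => by
    simp only [φ]
    rw [lieIter_ofReal hh hf dh df eh ef n θ (by linarith)]
    push_cast
    rfl
  classical
  let F : ℂ → BSeq := fun w =>
    if hw : w ∈ Metric.ball (θ₀ : ℂ) (R / 2) then ⟨fun n => φ n w, hmem w hw⟩ else 0
  have hF : ∀ w ∈ Metric.ball (θ₀ : ℂ) (R / 2), ∀ n, F w n = φ n w := fun w hw n => by
    simp only [F, dif_pos hw]
  have hco : ∀ θ, |θ - θ₀| < R / 2 → ∀ n,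
      lieSeq h f K θ n = ((lieIter h f n θ / (n.factorial * K ^ n) : ℝ) : ℂ) := fun θ hθ n => by
    have hm := hmem θ (hreal θ hθ)
    simp only [hφr θ hθ] at hm
    simp only [lieSeq, toBSeq, dif_pos hm]
  refine fun θ hθ => ⟨hco θ hθ, ?_⟩
  have hθb := hreal θ hθ
  obtain ⟨δ, hδ, hδs⟩ := Metric.isOpen_iff.1 Metric.isOpen_ball _ hθb
  have hFan : AnalyticAt ℂ F (θ : ℂ) :=
    analyticAt_bseq hδ (fun n => (hφd n).mono hδs) (fun n w hw => hφb n w (hδs hw))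
      (fun w hw => hF w (hδs hw))
  have hcomp : AnalyticAt ℝ (fun x : ℝ => F x) θ :=
    AnalyticAt.comp (g := F) (f := fun x : ℝ => (x : ℂ)) hFan.restrictScalars
      (Complex.ofRealCLM.analyticAt θ)
  refine hcomp.congr ?_
  have hop : IsOpen {y : ℝ | |y - θ₀| < R / 2} := isOpen_lt (by fun_prop) (by fun_prop)
  filter_upwards [hop.mem_nhds hθ] with y hy
  ext n
  rw [hF _ (hreal y hy), hco y hy, hφr y hy]

theorem periodic_mem_Icc {α : Type*} {f : ℝ → α} (hf : Function.Periodic f 1) (x : ℝ) :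
    ∃ y ∈ Icc (0 : ℝ) 1, f y = f x :=
  ⟨Int.fract x, ⟨Int.fract_nonneg x, (Int.fract_lt_one x).le⟩, by
    have := hf.sub_int_mul_eq (x := x) ⌊x⌋
    rw [mul_one] at this
    exact this⟩

/-- The Lie series of an analytic periodic function along an analytic periodic field. -/
theorem exists_lieSeq {h f : ℝ → ℝ} (hh : ∀ x, AnalyticAt ℝ h x)
    (hf : ∀ x, AnalyticAt ℝ f x) (ph : Function.Periodic h 1) (pf : Function.Periodic f 1) :
    ∃ K₀ > 0, ∀ K ≥ K₀,
      (∀ θ n, lieSeq h f K θ n = ((lieIter h f n θ / (n.factorial * K ^ n) : ℝ) : ℂ)) ∧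
      (∀ θ, AnalyticAt ℝ (lieSeq h f K) θ) ∧ Function.Periodic (lieSeq h f K) 1 := by
  have key : ∃ K₀ > 0, ∀ K ≥ K₀, ∀ θ ∈ Icc (0 : ℝ) 1,
      (∀ n, lieSeq h f K θ n = ((lieIter h f n θ / (n.factorial * K ^ n) : ℝ) : ℂ)) ∧
      AnalyticAt ℝ (lieSeq h f K) θ := by
    -- Asking for every `K ≥ K₀` makes the property stable under unions, by taking the larger
    -- threshold; compactness of a period then yields a single `K₀`.
    refine IsCompact.induction_on (p := fun s => ∃ K₀ > 0, ∀ K ≥ K₀, ∀ θ ∈ s,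
      (∀ n, lieSeq h f K θ n = ((lieIter h f n θ / (n.factorial * K ^ n) : ℝ) : ℂ)) ∧
      AnalyticAt ℝ (lieSeq h f K) θ) isCompact_Icc ⟨1, one_pos, by simp⟩ ?_ ?_ ?_
    · rintro s t hst ⟨K₀, h0, H⟩
      exact ⟨K₀, h0, fun K hK θ hθ => H K hK θ (hst hθ)⟩
    · rintro s t ⟨K₁, h1, H1⟩ ⟨K₂, h2, H2⟩
      refine ⟨max K₁ K₂, lt_max_of_lt_left h1, fun K hK θ hθ => ?_⟩
      rcases hθ with hθ | hθ
      · exact H1 K ((le_max_left _ _).trans hK) θ hθ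
      · exact H2 K ((le_max_right _ _).trans hK) θ hθ
    · intro θ₀ _
      obtain ⟨K₀, h0, R, hR, H⟩ := exists_lieSeq_local hh hf θ₀
      have hop : IsOpen {y : ℝ | |y - θ₀| < R} := isOpen_lt (by fun_prop) (by fun_prop)
      exact ⟨_, mem_nhdsWithin_of_mem_nhds (hop.mem_nhds (by simpa using hR)), K₀, h0, H⟩
  obtain ⟨K₀, h0, H⟩ := key
  refine ⟨K₀, h0, fun K hK => ?_⟩
  have hper : Function.Periodic (lieSeq h f K) 1 := fun θ => by
    simp only [lieSeq, fun n => lieIter_periodic ph pf n θ]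
  refine ⟨fun θ n => ?_, fun θ => ?_, hper⟩
  · have hi := hper.sub_int_mul_eq (x := θ) ⌊θ⌋
    have hi2 := (lieIter_periodic ph pf n).sub_int_mul_eq (x := θ) ⌊θ⌋
    rw [← hi, ← hi2, mul_one]
    exact (H K hK _ ⟨Int.fract_nonneg θ, (Int.fract_lt_one θ).le⟩).1 n
  · have h1 := (H K hK _ ⟨Int.fract_nonneg θ, (Int.fract_lt_one θ).le⟩).2
    have h2 : AnalyticAt ℝ (fun x : ℝ => lieSeq h f K (x - ⌊θ⌋)) θ :=
      AnalyticAt.comp (g := lieSeq h f K) (f := fun x : ℝ => x - (⌊θ⌋ : ℝ)) h1 (by fun_prop)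
    refine h2.congr (Eventually.of_forall fun x => ?_)
    have hi := hper.sub_int_mul_eq (x := x) ⌊θ⌋
    rwa [mul_one] at hi

/-! ### The real flow and its Taylor expansion -/

theorem exists_bound_of_periodic {E : Type*} [SeminormedAddCommGroup E] {f : ℝ → E}
    (hf : Continuous f) (pf : Function.Periodic f 1) : ∃ B, 0 ≤ B ∧ ∀ x, ‖f x‖ ≤ B := by
  obtain ⟨B, hB⟩ := (isCompact_Icc (a := (0 : ℝ)) (b := 1)).exists_bound_of_continuousOn
    hf.continuousOn
  refine ⟨B, (norm_nonneg _).trans (hB 0 (by simp)), fun x => ?_⟩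
  obtain ⟨y, hy, hxy⟩ := periodic_mem_Icc pf x
  rw [← hxy]
  exact hB y hy

/-- A periodic `C¹` vector field on the line is complete. -/
theorem exists_global_flow {h : ℝ → ℝ} (hh : ∀ x, AnalyticAt ℝ h x)
    (ph : Function.Periodic h 1) (θ : ℝ) :
    ∃ u : ℝ → ℝ, u 0 = θ ∧ ∀ t, HasDerivAt u (h (u t)) t := by
  have hc : Continuous h := continuous_iff_continuousAt.2 fun x => (hh x).continuousAt
  have hc' : Continuous (deriv h) := continuous_iff_continuousAt.2 fun x => (hh x).deriv.continuousAt
  obtain ⟨L, hL0, hL⟩ := exists_bound_of_periodic hc ph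
  obtain ⟨M, hM0, hM⟩ := exists_bound_of_periodic hc' (deriv_periodic ph)
  have hlip : LipschitzWith ⟨M, hM0⟩ h :=
    lipschitzWith_of_nnnorm_deriv_le (fun x => (hh x).differentiableAt) fun x => hM x
  have hex : ∀ n : ℕ, ∃ α : ℝ → ℝ, α 0 = θ ∧
      ∀ t ∈ Ioo (-((n : ℝ) + 1)) (n + 1), HasDerivAt α (h (α t)) t := fun n => by
    have hn : (0 : ℝ) ≤ n := Nat.cast_nonneg n
    have hz : (0 : ℝ) ∈ Icc (-((n : ℝ) + 1)) (n + 1) := ⟨by linarith, by linarith⟩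
    -- The field is bounded by `L` on the whole line, so radius `L * (n + 1)` in space suffices for
    -- time `n + 1`.
    have hp : IsPicardLindelof (fun _ => h) (⟨0, hz⟩ : Icc (-((n : ℝ) + 1)) ((n : ℝ) + 1)) θ
        (⟨L * (n + 1), by positivity⟩ : NNReal) 0 ⟨L, hL0⟩ ⟨M, hM0⟩ :=
      IsPicardLindelof.of_time_independent (fun x _ => hL x) (hlip.lipschitzOnWith) (by
        simp only [sub_zero, zero_sub, neg_neg, max_self, NNReal.coe_zero]
        exact le_rfl)
    obtain ⟨α, h0, hα⟩ := hp.exists_eq_forall_mem_Icc_hasDerivWithinAt₀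
    exact ⟨α, h0, fun t ht => (hα t (Ioo_subset_Icc_self ht)).hasDerivAt (Icc_mem_nhds ht.1 ht.2)⟩
  choose α hα0 hα using hex
  have huniq : ∀ m n : ℕ, m ≤ n → EqOn (α m) (α n) (Ioo (-((m : ℝ) + 1)) (m + 1)) := fun m n hmn => by
    have hm : (0 : ℝ) ≤ m := Nat.cast_nonneg m
    have hmn' : (m : ℝ) ≤ n := by exact_mod_cast hmn
    refine ODE_solution_unique_of_mem_Ioo (v := fun _ => h) (s := fun _ => univ)
      (K := ⟨M, hM0⟩) (t₀ := 0) (fun t _ => hlip.lipschitzOnWith) ⟨by linarith, by linarith⟩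
      (fun t ht => ⟨hα m t ht, trivial⟩) (fun t ht => ⟨hα n t ⟨?_, ?_⟩, trivial⟩)
      (by rw [hα0, hα0])
    · linarith [ht.1]
    · linarith [ht.2]
  -- The solutions on growing intervals agree by uniqueness; at time `t` one uses an interval just
  -- large enough to contain `t`.
  refine ⟨fun t => α ⌈|t|⌉₊ t, by simpa using hα0 _, fun t₀ => ?_⟩
  have hu : ∀ N : ℕ, ∀ t : ℝ, |t| ≤ N → α ⌈|t|⌉₊ t = α N t := fun N t ht => by
    refine huniq _ _ (Nat.ceil_le.2 ht) ?_
    have := Nat.le_ceil |t|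
    rw [mem_Ioo, ← abs_lt]
    linarith
  set N := ⌈|t₀|⌉₊ + 1 with hN
  have hlt : |t₀| < N := by
    have := Nat.le_ceil |t₀|
    rw [hN]; push_cast; linarith
  have hop : IsOpen {t : ℝ | |t| < N} := isOpen_lt (by fun_prop) (by fun_prop)
  have hd : HasDerivAt (α N) (h (α N t₀)) t₀ := hα N t₀ (by
    rw [mem_Ioo, ← abs_lt]; linarith)
  rw [← hu N t₀ hlt.le] at hd
  refine hd.congr_of_eventuallyEq ?_
  filter_upwards [hop.mem_nhds hlt] with t ht using hu N t (le_of_lt ht)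

/-- One integration step in the estimate of a Taylor remainder; negative times reduce to positive
ones by reflection. -/
theorem abs_le_of_abs_deriv_le_pow {R r : ℝ → ℝ} {B : ℝ} {N : ℕ}
    (hR : ∀ t, HasDerivAt R (r t) t) (h0 : R 0 = 0)
    (hr : ∀ t, |r t| ≤ B * |t| ^ N / N.factorial) (t : ℝ) :
    |R t| ≤ B * |t| ^ (N + 1) / (N + 1).factorial := by
  have key : ∀ {R r : ℝ → ℝ}, (∀ t, HasDerivAt R (r t) t) → R 0 = 0 →
      (∀ t, |r t| ≤ B * |t| ^ N / N.factorial) → ∀ t, 0 ≤ t →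
      |R t| ≤ B * |t| ^ (N + 1) / (N + 1).factorial := by
    intro R r hR h0 hr t ht
    have hder : ∀ x : ℝ, HasDerivAt (fun x : ℝ => B * x ^ (N + 1) / (N + 1).factorial)
        (B * x ^ N / N.factorial) x := fun x => by
      have := ((hasDerivAt_pow (N + 1) x).const_mul B).div_const ((N + 1).factorial : ℝ)
      refine this.congr_deriv ?_
      rw [Nat.factorial_succ]
      push_cast
      have : (N.factorial : ℝ) ≠ 0 := by positivity
      field_simp
    have := image_norm_le_of_norm_deriv_right_le_deriv_boundary (f := R) (f' := r) (a := 0) (b := t)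
      (fun x _ => (hR x).continuousAt.continuousWithinAt)
      (fun x _ => (hR x).hasDerivWithinAt)
      (B := fun x : ℝ => B * x ^ (N + 1) / (N + 1).factorial) (by simp [h0]) hder
      (fun x hx => by simpa [abs_of_nonneg hx.1] using hr x) (right_mem_Icc.2 ht)
    simpa [abs_of_nonneg ht] using this
  rcases le_total 0 t with ht | ht
  · exact key hR h0 hr t ht
  · have h2 := key (R := fun t => R (-t)) (r := fun t => - r (-t))
      (fun x => (HasDerivAt.comp x (hR (-x)) (hasDerivAt_neg x)).congr_deriv (by simp)) (by simpa using h0)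
      (fun x => by simpa using hr (-x)) (-t) (by linarith)
    simpa using h2

/-- Taylor's formula along an integral curve. -/
theorem taylor_lieIter {h : ℝ → ℝ} (hh : ∀ x, AnalyticAt ℝ h x) {u : ℝ → ℝ}
    (hu : ∀ t, HasDerivAt u (h (u t)) t) {B : ℝ} (N : ℕ) : ∀ {f : ℝ → ℝ},
    (∀ x, AnalyticAt ℝ f x) → (∀ t, |lieIter h f N (u t)| ≤ B) → ∀ t,
    |f (u t) - ∑ n ∈ Finset.range N, t ^ n / n.factorial * lieIter h f n (u 0)|
      ≤ B * |t| ^ N / N.factorial := by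
  induction N with
  | zero => intro f _ hB t; simpa [lieIter] using hB t
  | succ N ih =>
    intro f hf hB t
    -- The time derivative of the remainder of order `N + 1` for `f` is the remainder of order `N`
    -- for `h f'`.
    refine abs_le_of_abs_deriv_le_pow
      (R := fun t => f (u t) -
        ∑ n ∈ Finset.range (N + 1), t ^ n / n.factorial * lieIter h f n (u 0))
      (r := fun t => lieIter h f 1 (u t) -
        ∑ n ∈ Finset.range N, t ^ n / n.factorial * lieIter h (lieIter h f 1) n (u 0))
      (fun t => ?_) ?_ (fun t => ih (analyticAt_lieIter hh hf 1)
        (fun t => by rw [← lieIter_succ']; exact hB t) t) t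
    · refine HasDerivAt.sub ?_ ?_
      · have := (hf (u t)).differentiableAt.hasDerivAt.comp t (hu t)
        rw [mul_comm] at this
        exact this
      · have hs : ∀ t, ∑ n ∈ Finset.range (N + 1), t ^ n / n.factorial * lieIter h f n (u 0) =
            ∑ n ∈ Finset.range N, t ^ (n + 1) / (n + 1).factorial * lieIter h f (n + 1) (u 0) +
              f (u 0) := fun t => by
          rw [Finset.sum_range_succ']; simp [lieIter]
        simp only [hs]
        refine HasDerivAt.add_const _ (HasDerivAt.fun_sum fun n _ => ?_)
        rw [← lieIter_succ']
        have := ((hasDerivAt_pow (n + 1) t).div_const ((n + 1).factorial : ℝ)).mul_const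
          (lieIter h f (n + 1) (u 0))
        refine this.congr_deriv ?_
        rw [Nat.factorial_succ]
        push_cast
        have : (n.factorial : ℝ) ≠ 0 := by positivity
        field_simp
    · have : ∀ n ∈ Finset.range (N + 1), n ≠ 0 →
          (0 : ℝ) ^ n / n.factorial * lieIter h f n (u 0) = 0 := fun n _ hn => by simp [hn]
      rw [Finset.sum_eq_single_of_mem 0 (by simp) this]
      simp [lieIter]

/-- The Lie series sums to the composition with the flow. -/
theorem evalSeries_lieSeq {h f : ℝ → ℝ} (hh : ∀ x, AnalyticAt ℝ h x)
    (hf : ∀ x, AnalyticAt ℝ f x) {K : ℝ} (hK : 0 < K)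
    (hco : ∀ θ n, lieSeq h f K θ n = ((lieIter h f n θ / (n.factorial * K ^ n) : ℝ) : ℂ))
    (han : ∀ θ, AnalyticAt ℝ (lieSeq h f K) θ) (hper : Function.Periodic (lieSeq h f K) 1)
    {u : ℝ → ℝ} (hu : ∀ t, HasDerivAt u (h (u t)) t) {t : ℝ} (ht : |t| < 1 / K) :
    evalSeries K t (lieSeq h f K (u 0)) = f (u t) := by
  obtain ⟨C, hC0, hC⟩ := exists_bound_of_periodic
    (continuous_iff_continuousAt.2 fun x => (han x).continuousAt) hper
  -- Boundedness of the rescaled coefficients bounds the `N`-th remainder by `C * |K * t| ^ N`,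
  -- which tends to zero.
  have hb : ∀ N θ, |lieIter h f N θ| ≤ C * (N.factorial * K ^ N) := fun N θ => by
    have h1 := (lp.norm_apply_le_norm (by simp) (lieSeq h f K θ) N).trans (hC θ)
    rw [hco, Complex.norm_real, Real.norm_eq_abs, abs_div, div_le_iff₀ (by positivity)] at h1
    rwa [abs_of_pos (by positivity : (0 : ℝ) < N.factorial * K ^ N)] at h1
  have hs := (hasSum_evalSeries hK (lieSeq h f K (u 0)) (ζ := t) (by simpa using ht)).tendsto_sum_nat
  have hpart : ∀ N, ∑ n ∈ Finset.range N, ((K : ℂ) * t) ^ n * lieSeq h f K (u 0) n =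
      ((∑ n ∈ Finset.range N, t ^ n / n.factorial * lieIter h f n (u 0) : ℝ) : ℂ) := fun N => by
    push_cast
    refine Finset.sum_congr rfl fun n _ => ?_
    rw [hco]
    push_cast
    have : (K : ℂ) ≠ 0 := by exact_mod_cast hK.ne'
    have : (n.factorial : ℂ) ≠ 0 := by exact_mod_cast n.factorial_ne_zero
    rw [mul_pow]
    field_simp
  simp only [hpart] at hs
  have hKt : |K * t| < 1 := by
    rw [abs_mul, abs_of_pos hK]
    rwa [lt_div_iff₀ hK, mul_comm] at ht
  have hlim : Tendsto (fun N => ∑ n ∈ Finset.range N, t ^ n / n.factorial * lieIter h f n (u 0))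
      atTop (𝓝 (f (u t))) := by
    rw [tendsto_iff_norm_sub_tendsto_zero]
    have hg : Tendsto (fun N : ℕ => C * |K * t| ^ N) atTop (𝓝 0) := by
      simpa using (tendsto_pow_atTop_nhds_zero_of_lt_one (abs_nonneg _) hKt).const_mul C
    refine squeeze_zero (fun _ => norm_nonneg _) (fun N => ?_) hg
    have := taylor_lieIter hh hu N hf (fun t => hb N (u t)) t
    rw [norm_sub_rev, Real.norm_eq_abs]
    refine this.trans (le_of_eq ?_)
    rw [abs_mul, abs_of_pos hK, mul_pow]
    field_simp
  exact tendsto_nhds_unique hs (Complex.continuous_ofReal.continuousAt.tendsto.comp hlim)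

/-! ### Two-fold maps of the circle onto an interval -/

/-- `y` maps the circle onto `[m, M]`, folding it along exactly two points. -/
structure TwoFold (y : ℝ → ℝ) (m M : ℝ) : Prop where
  lt : m < M
  mem : ∀ θ, y θ ∈ Icc m M
  regular : ∀ θ, y θ ∈ Ioo m M → deriv y θ ≠ 0
  min : ∃ p, y p = m ∧ ∀ θ, y θ = m → ∃ k : ℤ, θ = p + k
  max : ∃ p, y p = M ∧ ∀ θ, y θ = M → ∃ k : ℤ, θ = p + k
  two : ∀ c ∈ Ioo m M, ∃ p q, y p = c ∧ y q = c ∧ (∀ k : ℤ, q ≠ p + k) ∧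
    ∀ θ, y θ = c → (∃ k : ℤ, θ = p + k) ∨ ∃ k : ℤ, θ = q + k

theorem TwoFold.neg {y : ℝ → ℝ} {m M : ℝ} (H : TwoFold y m M) :
    TwoFold (fun θ => -y θ) (-M) (-m) where
  lt := neg_lt_neg H.lt
  mem θ := ⟨neg_le_neg (H.mem θ).2, neg_le_neg (H.mem θ).1⟩
  regular θ hθ := by
    rw [deriv.fun_neg, neg_ne_zero]
    exact H.regular θ ⟨neg_lt_neg_iff.1 hθ.2, neg_lt_neg_iff.1 hθ.1⟩
  min := by simpa using H.max
  max := by simpa using H.min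
  two c hc := by
    obtain ⟨p, q, hp, hq, hpq, h⟩ := H.two (-c) ⟨by linarith [hc.2], by linarith [hc.1]⟩
    exact ⟨p, q, by linarith, by linarith, hpq, fun θ hθ => h θ (by linarith)⟩

theorem periodic_add_int {α : Type*} {f : ℝ → α} (hf : Function.Periodic f 1) (x : ℝ) (k : ℤ) :
    f (x + k) = f x := by
  simpa using hf.int_mul k x

/-- A minimum and a maximum already account for the two critical points. On each of the two arcs
between them Rolle's theorem forces injectivity, and the intermediate value theorem gives one
preimage per arc. -/
theorem twoFold_of_critical {y : ℝ → ℝ} (hy : Differentiable ℝ y) (py : Function.Periodic y 1)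
    (hcrit : {θ ∈ Ico (0 : ℝ) 1 | deriv y θ = 0}.ncard = 2) :
    ∃ m M, TwoFold y m M := by
  have hcont : Continuous y := hy.continuous
  obtain ⟨s₀, -, hs₀⟩ := (isCompact_Icc (a := (0 : ℝ)) (b := 1)).exists_isMinOn
    ⟨0, by simp⟩ hcont.continuousOn
  obtain ⟨s₁, -, hs₁⟩ := (isCompact_Icc (a := (0 : ℝ)) (b := 1)).exists_isMaxOn
    ⟨0, by simp⟩ hcont.continuousOn
  have hfr : ∀ x : ℝ, y (Int.fract x) = y x := fun x => by
    rw [← periodic_add_int py (Int.fract x) ⌊x⌋, Int.fract_add_floor]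
  have hmin : ∀ x, y s₀ ≤ y x := fun x => by
    rw [← hfr x]; exact hs₀ ⟨Int.fract_nonneg x, (Int.fract_lt_one x).le⟩
  have hmax : ∀ x, y x ≤ y s₁ := fun x => by
    rw [← hfr x]; exact hs₁ ⟨Int.fract_nonneg x, (Int.fract_lt_one x).le⟩
  set m := y s₀ with hm
  set M := y s₁ with hM
  have hdm : ∀ x, y x = m → deriv y x = 0 := fun x hx =>
    IsLocalMin.deriv_eq_zero (Eventually.of_forall fun t => by rw [hx]; exact hmin t)
  have hdM : ∀ x, y x = M → deriv y x = 0 := fun x hx =>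
    IsLocalMax.deriv_eq_zero (Eventually.of_forall fun t => by rw [hx]; exact hmax t)
  have hlt : m < M := by
    rcases (hmin s₁).lt_or_eq with h | h
    · exact h
    · exfalso
      have hall : ∀ x, deriv y x = 0 := fun x => hdm x
        (le_antisymm (by rw [h]; exact hmax x) (hmin x))
      have : {θ ∈ Ico (0 : ℝ) 1 | deriv y θ = 0} = Ico (0 : ℝ) 1 := by
        ext x; simp [hall x]
      rw [this, (Ico_infinite (zero_lt_one (α := ℝ))).ncard] at hcrit
      omega
  set t₀ := Int.fract s₀ with ht₀
  set t₁ := Int.fract s₁ with ht₁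
  have yt₀ : y t₀ = m := hfr s₀
  have yt₁ : y t₁ = M := hfr s₁
  have hne : t₀ ≠ t₁ := fun h => hlt.ne (by rw [← yt₀, ← yt₁, h])
  have hset : {t₀, t₁} = {θ ∈ Ico (0 : ℝ) 1 | deriv y θ = 0} := by
    refine Set.eq_of_subset_of_ncard_le ?_ ?_ (Set.finite_of_ncard_ne_zero (by omega))
    · rintro x (rfl | rfl)
      · exact ⟨⟨Int.fract_nonneg _, Int.fract_lt_one _⟩, hdm _ yt₀⟩
      · exact ⟨⟨Int.fract_nonneg _, Int.fract_lt_one _⟩, hdM _ yt₁⟩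
    · rw [hcrit, Set.ncard_pair hne]
  have hcr : ∀ x, deriv y x = 0 → (∃ k : ℤ, x = t₀ + k) ∨ ∃ k : ℤ, x = t₁ + k := fun x hx => by
    have hx' : deriv y (Int.fract x) = 0 := by
      have := periodic_add_int (deriv_periodic py) (Int.fract x) ⌊x⌋
      rw [Int.fract_add_floor] at this
      rw [← this, hx]
    have hmem : Int.fract x ∈ ({t₀, t₁} : Set ℝ) := by
      rw [hset]; exact ⟨⟨Int.fract_nonneg _, Int.fract_lt_one _⟩, hx'⟩
    rcases hmem with h | h
    · exact Or.inl ⟨⌊x⌋, by rw [← h, Int.fract_add_floor]⟩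
    · exact Or.inr ⟨⌊x⌋, by rw [← h, Int.fract_add_floor]⟩
  have hreg : ∀ x, y x ∈ Ioo m M → deriv y x ≠ 0 := fun x hx h0 => by
    rcases hcr x h0 with ⟨k, rfl⟩ | ⟨k, rfl⟩
    · rw [periodic_add_int py, yt₀] at hx; exact lt_irrefl _ hx.1
    · rw [periodic_add_int py, yt₁] at hx; exact lt_irrefl _ hx.2
  refine ⟨m, M, ⟨hlt, fun θ => ⟨hmin θ, hmax θ⟩, hreg, ⟨t₀, yt₀, fun θ hθ => ?_⟩,
    ⟨t₁, yt₁, fun θ hθ => ?_⟩, fun c hc => ?_⟩⟩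
  · rcases hcr θ (hdm θ hθ) with h | ⟨k, rfl⟩
    · exact h
    · rw [periodic_add_int py, yt₁] at hθ; exact absurd hθ hlt.ne'
  · rcases hcr θ (hdM θ hθ) with ⟨k, rfl⟩ | h
    · rw [periodic_add_int py, yt₀] at hθ; exact absurd hθ hlt.ne
    · exact h
  -- `b` is the representative of the maximum in the period starting at the minimum `t₀`; the two
  -- arcs are `[t₀, b]` and `[b, t₀ + 1]`.
  · obtain ⟨b, hb0, hb1, yb, kb, hkb⟩ : ∃ b, t₀ < b ∧ b < t₀ + 1 ∧ y b = M ∧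
        ∃ k : ℤ, b = t₁ + k := by
      rcases hne.lt_or_gt with h | h
      · refine ⟨t₁, h, ?_, yt₁, 0, by simp⟩
        linarith [Int.fract_lt_one s₁, Int.fract_nonneg s₀]
      · refine ⟨t₁ + 1, ?_, by linarith, by rw [py, yt₁], 1, by simp⟩
        linarith [Int.fract_lt_one s₀, Int.fract_nonneg s₁]
    have hnocrit : ∀ x, t₀ < x → x < t₀ + 1 → x ≠ b → deriv y x ≠ 0 := fun x h0 h1 hxb hd => by
      rcases hcr x hd with ⟨k, rfl⟩ | ⟨k, rfl⟩
      · have h2 : (0 : ℝ) < k := by linarith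
        have h3 : (k : ℝ) < 1 := by linarith
        have h2' : (0 : ℤ) < k := by exact_mod_cast h2
        have h3' : k < 1 := by exact_mod_cast h3
        omega
      · have hkk : k ≠ kb := fun h => hxb (by rw [hkb, h])
        rcases lt_or_gt_of_ne hkk with h | h
        · have : (k : ℝ) + 1 ≤ kb := by exact_mod_cast h
          linarith
        · have : (kb : ℝ) + 1 ≤ k := by exact_mod_cast h
          linarith
    have hinj : ∀ u v : ℝ, t₀ ≤ u → u < v → v ≤ t₀ + 1 → (v ≤ b ∨ b ≤ u) → y u ≠ y v := by
      intro u v hu huv hv hb hyy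
      obtain ⟨x, hx, hdx⟩ := exists_deriv_eq_zero huv hcont.continuousOn hyy
      refine hnocrit x (lt_of_le_of_lt hu hx.1) (lt_of_lt_of_le hx.2 hv) ?_ hdx
      rintro rfl
      rcases hb with h | h
      · exact absurd hx.2 (not_lt.2 h)
      · exact absurd hx.1 (not_lt.2 h)
    obtain ⟨p, hp, yp⟩ := intermediate_value_Ioo hb0.le hcont.continuousOn
      (show c ∈ Ioo (y t₀) (y b) by rw [yt₀, yb]; exact hc)
    obtain ⟨q, hq, yq⟩ := intermediate_value_Ioo' hb1.le hcont.continuousOn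
      (show c ∈ Ioo (y (t₀ + 1)) (y b) by rw [py, yt₀, yb]; exact hc)
    refine ⟨p, q, yp, yq, fun k hk => ?_, fun θ hθ => ?_⟩
    · have h2 : (0 : ℝ) < k := by linarith [hp.2, hq.1]
      have h3 : (k : ℝ) < 1 := by linarith [hp.1, hq.2]
      have h2' : (0 : ℤ) < k := by exact_mod_cast h2
      have h3' : k < 1 := by exact_mod_cast h3
      omega
    · set v := t₀ + Int.fract (θ - t₀) with hv
      have hθv : θ = v + ⌊θ - t₀⌋ := by
        have := Int.fract_add_floor (θ - t₀)
        rw [hv]; linarith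
      have hv0 : t₀ ≤ v := by linarith [Int.fract_nonneg (θ - t₀)]
      have hv1 : v < t₀ + 1 := by linarith [Int.fract_lt_one (θ - t₀)]
      have yv : y v = c := by rw [← hθ, hθv, periodic_add_int py]
      rcases le_total v b with hvb | hvb
      · left
        refine ⟨⌊θ - t₀⌋, ?_⟩
        rcases lt_trichotomy v p with h | h | h
        · exact absurd (yv.trans yp.symm) (hinj v p hv0 h (by linarith [hp.2]) (Or.inl hp.2.le))
        · rw [← h]; exact hθv
        · exact absurd (yp.trans yv.symm) (hinj p v hp.1.le h hv1.le (Or.inl hvb))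
      · right
        refine ⟨⌊θ - t₀⌋, ?_⟩
        rcases lt_trichotomy v q with h | h | h
        · exact absurd (yv.trans yq.symm) (hinj v q hv0 h hq.2.le (Or.inr hvb))
        · rw [← h]; exact hθv
        · exact absurd (yq.trans yv.symm) (hinj q v (by linarith [hq.1]) h hv1.le (Or.inr hq.1.le))

/-- Points of nearby fibres are close to the fibre. -/
theorem eventually_fibre_mem {y : ℝ → ℝ} (hy : Continuous y) (py : Function.Periodic y 1) {c : ℝ}
    {V : Set ℝ} (hV : ∀ θ, y θ = c → ∃ k : ℤ, V ∈ 𝓝 (θ - k)) :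
    ∀ᶠ c' in 𝓝 c, ∀ θ, y θ = c' → ∃ k : ℤ, θ - k ∈ V := by
  -- `U` is the union of the integer translates of the interior of `V`. The part of a period outside
  -- `U` is compact, so its image is closed; it misses `c`, hence also all nearby values.
  let U : Set ℝ := ⋃ k : ℤ, (fun θ : ℝ => θ - k) ⁻¹' interior V
  have hU : IsOpen U := isOpen_iUnion fun k => isOpen_interior.preimage (by fun_prop)
  have hcl : IsClosed (y '' (Icc 0 1 \ U)) :=
    ((isCompact_Icc.diff hU).image hy).isClosed
  have hc : c ∉ y '' (Icc 0 1 \ U) := by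
    rintro ⟨θ, ⟨-, hθU⟩, hθ⟩
    obtain ⟨k, hk⟩ := hV θ hθ
    exact hθU (mem_iUnion.2 ⟨k, mem_interior_iff_mem_nhds.2 hk⟩)
  filter_upwards [hcl.isOpen_compl.mem_nhds hc] with c' hc' θ hθ
  have hfr : y (Int.fract θ) = y θ := by
    rw [← periodic_add_int py (Int.fract θ) ⌊θ⌋, Int.fract_add_floor]
  by_contra hcon
  refine hc' ⟨Int.fract θ, ⟨⟨Int.fract_nonneg _, (Int.fract_lt_one _).le⟩, fun hmem => ?_⟩,
    hfr.trans hθ⟩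
  obtain ⟨k, hk⟩ := mem_iUnion.1 hmem
  refine hcon ⟨⌊θ⌋ + k, ?_⟩
  have : θ - ((⌊θ⌋ + k : ℤ) : ℝ) = Int.fract θ - k := by
    rw [Int.fract]; push_cast; ring
  rw [this]
  exact interior_subset hk

theorem exists_local_inverse {f : ℝ → ℝ} {p : ℝ} (hf : AnalyticAt ℝ f p) (hd : deriv f p ≠ 0) :
    ∃ r : ℝ → ℝ, AnalyticAt ℝ r (f p) ∧ r (f p) = p ∧ (∀ᶠ c in 𝓝 (f p), f (r c) = c) ∧
      ∀ᶠ t in 𝓝 p, r (f t) = t := by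
  have hs := hf.hasStrictDerivAt
  refine ⟨hs.localInverse _ _ _ hd, hf.analyticAt_localInverse hd, ?_, ?_, ?_⟩
  · exact (hs.eventually_left_inverse hd).self_of_nhds
  · exact hs.eventually_right_inverse hd
  · exact hs.eventually_left_inverse hd

/-! ### Affine interpolation along fibres -/

section Interp

variable {E : Type*} [NormedAddCommGroup E] [NormedSpace ℝ E]

/-- Splitting a power series into its even and odd parts. -/
theorem exists_even_odd [CompleteSpace E] {H : ℝ → E} (hH : AnalyticAt ℝ H 0) :
    ∃ G₀ G₁ : ℝ → E, AnalyticAt ℝ G₀ 0 ∧ AnalyticAt ℝ G₁ 0 ∧ G₁ 0 = deriv H 0 ∧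
      ∀ᶠ s in 𝓝 0, H s = G₀ (s ^ 2) + s • G₁ (s ^ 2) := by
  obtain ⟨p, r, hp⟩ := hH
  obtain ⟨r', hr'0, hr'⟩ := ENNReal.lt_iff_exists_nnreal_btwn.1 hp.r_pos
  have hr0 : (0 : ℝ) < r' := by
    rw [ENNReal.coe_pos] at hr'0
    exact_mod_cast hr'0
  obtain ⟨C, hC0, hC⟩ := p.norm_mul_pow_le_of_lt_radius (hr'.trans_le hp.r_le)
  have hc : ∀ n, ‖p.coeff n‖ * (r' : ℝ) ^ n ≤ C := fun n => by
    rw [← p.norm_apply_eq_norm_coef]; exact hC n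
  have hc0 : ∀ n, ‖p.coeff (2 * n)‖ * ((r' : ℝ) ^ 2) ^ n ≤ C := fun n => by
    rw [← pow_mul]; exact hc _
  have hc1 : ∀ n, ‖p.coeff (2 * n + 1)‖ * ((r' : ℝ) ^ 2) ^ n ≤ C / r' := fun n => by
    rw [← pow_mul, le_div_iff₀ hr0, mul_assoc, ← pow_succ]; exact hc _
  have hr2 : (0 : ℝ) < (r' : ℝ) ^ 2 := by positivity
  let G₀ : ℝ → E := fun u => ∑' n, u ^ n • p.coeff (2 * n)
  let G₁ : ℝ → E := fun u => ∑' n, u ^ n • p.coeff (2 * n + 1)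
  have a0 : AnalyticAt ℝ G₀ 0 := analyticOnNhd_tsum_pow_smul hr2 hc0 0 (Metric.mem_ball_self hr2)
  have a1 : AnalyticAt ℝ G₁ 0 := analyticOnNhd_tsum_pow_smul hr2 hc1 0 (Metric.mem_ball_self hr2)
  have hev : ∀ᶠ s in 𝓝 0, H s = G₀ (s ^ 2) + s • G₁ (s ^ 2) := by
    filter_upwards [Metric.ball_mem_nhds (0 : ℝ) hr0] with s hs
    have hs' : ‖s‖ < r' := by simpa using hs
    have hsr : s ∈ Metric.eball (0 : ℝ) r := by
      refine Metric.eball_subset_eball hr'.le ?_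
      rw [Metric.mem_eball, edist_nndist, ENNReal.coe_lt_coe]
      exact_mod_cast hs
    have hsum := hp.hasSum hsr
    simp only [zero_add, FormalMultilinearSeries.apply_eq_pow_smul_coeff] at hsum
    have hs2 : ‖s ^ 2‖ < (r' : ℝ) ^ 2 := by
      rw [norm_pow]; exact pow_lt_pow_left₀ hs' (norm_nonneg _) two_ne_zero
    have h0 := (summable_pow_smul hc0 hs2).hasSum
    have h1 := (summable_pow_smul hc1 hs2).hasSum.const_smul s
    have h0' : HasSum (fun n => s ^ (2 * n) • p.coeff (2 * n)) (G₀ (s ^ 2)) := by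
      simpa only [← pow_mul, G₀] using h0
    have h1' : HasSum (fun n => s ^ (2 * n + 1) • p.coeff (2 * n + 1)) (s • G₁ (s ^ 2)) := by
      simpa only [← pow_mul, smul_smul, ← pow_succ', G₁] using h1
    exact hsum.unique (HasSum.even_add_odd h0' h1')
  -- Only the term `s • G₁ (s ^ 2)` contributes to the derivative at `0`, since `s ^ 2` is
  -- stationary there.
  refine ⟨G₀, G₁, a0, a1, ?_, hev⟩
  have hz : (0 : ℝ) ^ 2 = 0 := by simp
  have d2 : HasDerivAt (fun s : ℝ => s ^ 2) 0 0 := by simpa using hasDerivAt_pow 2 (0 : ℝ)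
  have d0 : HasDerivAt (fun s : ℝ => G₀ (s ^ 2)) ((0 : ℝ) • deriv G₀ 0) 0 := by
    refine HasDerivAt.scomp (0 : ℝ) (g₁ := G₀) (h := fun s : ℝ => s ^ 2) ?_ d2
    rw [hz]; exact a0.differentiableAt.hasDerivAt
  have d1 : HasDerivAt (fun s : ℝ => G₁ (s ^ 2)) ((0 : ℝ) • deriv G₁ 0) 0 := by
    refine HasDerivAt.scomp (0 : ℝ) (g₁ := G₁) (h := fun s : ℝ => s ^ 2) ?_ d2
    rw [hz]; exact a1.differentiableAt.hasDerivAt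
  have d3 := d0.add ((hasDerivAt_id (0 : ℝ)).smul d1)
  have d4 : HasDerivAt H (G₁ 0) 0 := by
    refine (d3.congr_of_eventuallyEq hev).congr_deriv ?_
    simp
  exact d4.deriv.symm

/-- Interpolation near a regular value. -/
theorem interp_local_regular {y g : ℝ → ℝ} {F : ℝ → E} (hy : ∀ θ, AnalyticAt ℝ y θ)
    (hg : ∀ θ, AnalyticAt ℝ g θ) (hF : ∀ θ, AnalyticAt ℝ F θ) (py : Function.Periodic y 1)
    (pg : Function.Periodic g 1) (pF : Function.Periodic F 1)
    (hsep : ∀ θ θ', y θ = y θ' → g θ = g θ' → ∃ k : ℤ, θ' = θ + k)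
    {m M : ℝ} (H : TwoFold y m M) {c : ℝ} (hc : c ∈ Ioo m M) :
    ∃ a b : ℝ → E, AnalyticAt ℝ a c ∧ AnalyticAt ℝ b c ∧
      ∀ᶠ c' in 𝓝 c, ∀ θ, y θ = c' → F θ = a c' + g θ • b c' := by
  obtain ⟨p, q, yp, yq, hpq, hfib⟩ := H.two c hc
  have hycont : Continuous y := continuous_iff_continuousAt.2 fun x => (hy x).continuousAt
  obtain ⟨rp, arp, rp0, -, lp⟩ := exists_local_inverse (hy p) (H.regular p (by rwa [yp]))
  obtain ⟨rq, arq, rq0, -, lq⟩ := exists_local_inverse (hy q) (H.regular q (by rwa [yq]))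
  rw [yp] at arp rp0
  rw [yq] at arq rq0
  have agp : AnalyticAt ℝ (fun c => g (rp c)) c :=
    AnalyticAt.comp (g := g) (f := rp) (hg _) arp
  have agq : AnalyticAt ℝ (fun c => g (rq c)) c :=
    AnalyticAt.comp (g := g) (f := rq) (hg _) arq
  have aFp : AnalyticAt ℝ (fun c => F (rp c)) c :=
    AnalyticAt.comp (g := F) (f := rp) (hF _) arp
  have aFq : AnalyticAt ℝ (fun c => F (rq c)) c :=
    AnalyticAt.comp (g := F) (f := rq) (hF _) arq
  have hne : g (rp c) - g (rq c) ≠ 0 := by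
    rw [rp0, rq0, sub_ne_zero]
    intro h
    obtain ⟨k, hk⟩ := hsep p q (yp.trans yq.symm) h
    exact hpq k hk
  -- Solution of the two interpolation equations at the ends of the fibre: a divided difference
  -- between the branches `rp` and `rq`.
  let b : ℝ → E := fun c => (g (rp c) - g (rq c))⁻¹ • (F (rp c) - F (rq c))
  have ab : AnalyticAt ℝ b c := ((agp.sub agq).inv hne).smul (aFp.sub aFq)
  refine ⟨fun c => F (rp c) - g (rp c) • b c, b, aFp.sub (agp.smul ab), ab, ?_⟩
  let V : Set ℝ := {t | rp (y t) = t} ∪ {t | rq (y t) = t}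
  have hV := eventually_fibre_mem hycont py (c := c) (V := V) fun θ hθ => by
    rcases hfib θ hθ with ⟨k, rfl⟩ | ⟨k, rfl⟩
    · exact ⟨k, by rw [add_sub_cancel_right]; exact mem_of_superset lp subset_union_left⟩
    · exact ⟨k, by rw [add_sub_cancel_right]; exact mem_of_superset lq subset_union_right⟩
  filter_upwards [hV, (agp.sub agq).continuousAt.eventually_ne hne] with c' hc' hne' θ hθ
  obtain ⟨k, hk⟩ := hc' θ hθ
  have hyk : y (θ - k) = c' := by
    rw [← hθ, ← periodic_add_int py (θ - k) k, sub_add_cancel]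
  have hgk : g θ = g (θ - k) := by rw [← periodic_add_int pg (θ - k) k, sub_add_cancel]
  have hFk : F θ = F (θ - k) := by rw [← periodic_add_int pF (θ - k) k, sub_add_cancel]
  rw [hgk, hFk]
  rcases hk with h | h
  · have h' : rp c' = θ - k := by rw [← hyk]; exact h
    simp only [h']; abel
  · have h' : rq c' = θ - k := by rw [← hyk]; exact h
    have hb : (g (rp c') - g (rq c')) • b c' = F (rp c') - F (rq c') := by
      simp only [b]; rw [smul_smul, mul_inv_cancel₀ (by exact hne'), one_smul]
    rw [← h']
    rw [sub_smul] at hb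
    have : F (rp c') - g (rp c') • b c' + g (rq c') • b c' =
      F (rp c') - (g (rp c') • b c' - g (rq c') • b c') := by abel
    rw [this, hb]; abel

/-- A Morse coordinate at a nondegenerate minimum. -/
theorem exists_morse {y : ℝ → ℝ} {t₀ : ℝ} (hy : AnalyticAt ℝ y t₀) (hmin : ∀ t, y t₀ ≤ y t)
    (hd : deriv (deriv y) t₀ ≠ 0) :
    ∃ φ : ℝ → ℝ, AnalyticAt ℝ φ t₀ ∧ φ t₀ = 0 ∧ deriv φ t₀ ≠ 0 ∧
      ∀ᶠ t in 𝓝 t₀, y t = y t₀ + φ t ^ 2 := by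
  have hd0 : deriv y t₀ = 0 := IsLocalMin.deriv_eq_zero (Eventually.of_forall hmin)
  have hdsl : ∀ {f : ℝ → ℝ}, AnalyticAt ℝ f t₀ → AnalyticAt ℝ (dslope f t₀) t₀ :=
    fun ⟨p, hp⟩ => ⟨_, hp.has_fpower_series_dslope_fslope⟩
  -- Second divided difference: `y - y t₀ = (t - t₀) ^ 2 * k` with `y''(t₀) = 2 k(t₀)`. Minimality
  -- and nondegeneracy give `k t₀ > 0`, and the Morse coordinate is `(t - t₀) √k`.
  set k := dslope (dslope y t₀) t₀ with hk
  have ak : AnalyticAt ℝ k t₀ := hdsl (hdsl hy)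
  have hfac : ∀ t, y t = y t₀ + (t - t₀) ^ 2 * k t := fun t => by
    have h1 := sub_smul_dslope y t₀ t
    have h2 := sub_smul_dslope (dslope y t₀) t₀ t
    rw [dslope_same, hd0, sub_zero] at h2
    simp only [smul_eq_mul] at h1 h2
    rw [hk, pow_two, mul_assoc, h2, h1]; ring
  have hdk : deriv (deriv y) t₀ = 2 * k t₀ := by
    have h1 : ∀ᶠ t in 𝓝 t₀, deriv y t = (t - t₀) * (2 * k t + (t - t₀) * deriv k t) := by
      filter_upwards [ak.eventually_analyticAt] with t ht
      have h2 : HasDerivAt (fun t => y t₀ + (t - t₀) ^ 2 * k t)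
          (2 * (t - t₀) * k t + (t - t₀) ^ 2 * deriv k t) t := by
        have h3 := ((((hasDerivAt_id t).sub_const t₀).pow 2).mul
          ht.differentiableAt.hasDerivAt).const_add (y t₀)
        refine h3.congr_deriv ?_
        simp
      rw [← funext hfac] at h2
      rw [h2.deriv]; ring
    have h4 : HasDerivAt (fun t => (t - t₀) * (2 * k t + (t - t₀) * deriv k t)) (2 * k t₀) t₀ := by
      have h5 := ((hasDerivAt_id t₀).sub_const t₀).mul
        (((ak.differentiableAt.hasDerivAt).const_mul 2).add
          (((hasDerivAt_id t₀).sub_const t₀).mul ak.deriv.differentiableAt.hasDerivAt))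
      refine h5.congr_deriv ?_
      simp
    exact (h4.congr_of_eventuallyEq h1).deriv
  have hk0 : 0 < k t₀ := by
    have hne : k t₀ ≠ 0 := fun h => hd (by rw [hdk, h, mul_zero])
    refine lt_of_le_of_ne ?_ hne.symm
    by_contra hneg
    have hev := ak.continuousAt.eventually_lt continuousAt_const (not_le.1 hneg)
    have hev' : ∀ᶠ t in 𝓝[≠] t₀, k t < 0 := hev.filter_mono nhdsWithin_le_nhds
    obtain ⟨t, ht, htne⟩ := (hev'.and self_mem_nhdsWithin).exists
    have h1 := hmin t
    have h2 : 0 < (t - t₀) ^ 2 := by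
      have : t - t₀ ≠ 0 := sub_ne_zero.2 htne
      positivity
    have h3 := hfac t
    nlinarith
  -- The square root of `k`, in a form that is visibly analytic where `k > 0`.
  let σ : ℝ → ℝ := fun t => Real.exp (Real.log (k t) / 2)
  have aσ : AnalyticAt ℝ σ t₀ := by
    have : AnalyticAt ℝ (fun t => Real.log (k t) / 2) t₀ := by
      simp only [div_eq_mul_inv]
      exact (ak.log hk0).mul analyticAt_const
    exact this.rexp
  refine ⟨fun t => (t - t₀) * σ t, (by fun_prop : AnalyticAt ℝ (fun t => t - t₀) t₀).mul aσ,
    by simp, ?_, ?_⟩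
  · have h5 := ((hasDerivAt_id t₀).sub_const t₀).mul aσ.differentiableAt.hasDerivAt
    have h6 : HasDerivAt (fun t => (t - t₀) * σ t) (σ t₀) t₀ := h5.congr_deriv (by simp)
    rw [h6.deriv]
    exact (Real.exp_pos _).ne'
  · filter_upwards [ak.continuousAt.eventually (lt_mem_nhds hk0)] with t ht
    rw [hfac t, mul_pow]
    congr 2
    simp only [σ]
    rw [← Real.exp_nat_mul]
    push_cast
    rw [mul_div_cancel₀ _ two_ne_zero, Real.exp_log ht]

/-- Interpolation near the minimal value. -/
theorem interp_local_min [CompleteSpace E] {y g : ℝ → ℝ} {F : ℝ → E} (hy : ∀ θ, AnalyticAt ℝ y θ)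
    (hg : ∀ θ, AnalyticAt ℝ g θ) (hF : ∀ θ, AnalyticAt ℝ F θ) (py : Function.Periodic y 1)
    (pg : Function.Periodic g 1) (pF : Function.Periodic F 1)
    (himm : ∀ θ, deriv y θ = 0 → deriv g θ ≠ 0)
    (hnd : ∀ θ, deriv y θ = 0 → deriv (deriv y) θ ≠ 0)
    {m M : ℝ} (H : TwoFold y m M) :
    ∃ a b : ℝ → E, AnalyticAt ℝ a m ∧ AnalyticAt ℝ b m ∧
      ∀ᶠ c' in 𝓝 m, ∀ θ, y θ = c' → F θ = a c' + g θ • b c' := by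
  obtain ⟨t₀, yt₀, hfib⟩ := H.min
  have hycont : Continuous y := continuous_iff_continuousAt.2 fun x => (hy x).continuousAt
  have hmin : ∀ t, y t₀ ≤ y t := fun t => by rw [yt₀]; exact (H.mem t).1
  have hd0 : deriv y t₀ = 0 := IsLocalMin.deriv_eq_zero (Eventually.of_forall hmin)
  obtain ⟨φ, aφ, φ0, dφ, hφ⟩ := exists_morse (hy t₀) hmin (hnd t₀ hd0)
  obtain ⟨ψ, aψ, ψ0, rψ, lψ⟩ := exists_local_inverse aφ dφ
  rw [φ0] at aψ ψ0 rψ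
  have dψ : deriv ψ 0 ≠ 0 := by
    have h1 : HasDerivAt (fun s => φ (ψ s)) (deriv φ t₀ * deriv ψ 0) 0 := by
      refine HasDerivAt.comp (0 : ℝ) (h₂ := φ) (h := ψ) ?_ aψ.differentiableAt.hasDerivAt
      rw [ψ0]; exact aφ.differentiableAt.hasDerivAt
    have h2 : HasDerivAt (fun s => φ (ψ s)) 1 0 := (hasDerivAt_id (0 : ℝ)).congr_of_eventuallyEq rψ
    intro h
    have := h1.unique h2
    rw [h, mul_zero] at this
    exact zero_ne_one this
  have agψ : AnalyticAt ℝ (fun s => g (ψ s)) 0 := AnalyticAt.comp (g := g) (f := ψ) (hg _) aψ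
  have aFψ : AnalyticAt ℝ (fun s => F (ψ s)) 0 := AnalyticAt.comp (g := F) (f := ψ) (hF _) aψ
  obtain ⟨g₀, g₁, ag₀, ag₁, hg₁, heg⟩ := exists_even_odd agψ
  obtain ⟨F₀, F₁, aF₀, aF₁, -, heF⟩ := exists_even_odd aFψ
  have hg₁0 : g₁ 0 ≠ 0 := by
    have h1 : HasDerivAt (fun s => g (ψ s)) (deriv g t₀ * deriv ψ 0) 0 := by
      refine HasDerivAt.comp (0 : ℝ) (h₂ := g) (h := ψ) ?_ aψ.differentiableAt.hasDerivAt
      rw [ψ0]; exact (hg t₀).differentiableAt.hasDerivAt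
    rw [hg₁, h1.deriv]
    exact mul_ne_zero (himm t₀ hd0) dψ
  have hshift : ∀ {E' : Type _} [NormedAddCommGroup E'] [NormedSpace ℝ E'] {f : ℝ → E'},
      AnalyticAt ℝ f 0 → AnalyticAt ℝ (fun c => f (c - m)) m := fun {E' _ _ f} hf =>
    AnalyticAt.comp (g := f) (f := fun c : ℝ => c - m) (by simpa using hf) (by fun_prop)
  -- With `s` the Morse coordinate and `u = s ^ 2 = c - m`, one has `g = g₀(u) + s g₁(u)` and `F =
  -- F₀(u) + s F₁(u)`. Eliminating `s` gives the slope `F₁ / g₁`; here `g₁ 0 ≠ 0` because `g` is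
  -- immersive where `y` is critical.
  let b : ℝ → E := fun c => (g₁ (c - m))⁻¹ • F₁ (c - m)
  have ab : AnalyticAt ℝ b m := by
    have ha := AnalyticAt.comp (g := g₁) (f := fun c : ℝ => c - m) (x := m) (by simpa using ag₁)
      (by fun_prop)
    exact (ha.inv (by simpa using hg₁0)).smul (hshift aF₁)
  have ag₀' := AnalyticAt.comp (g := g₀) (f := fun c : ℝ => c - m) (x := m) (by simpa using ag₀)
      (by fun_prop)
  refine ⟨fun c => F₀ (c - m) - g₀ (c - m) • b c, b, (hshift aF₀).sub (ag₀'.smul ab), ab, ?_⟩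
  have hφt : Tendsto φ (𝓝 t₀) (𝓝 0) := by
    have := aφ.continuousAt.tendsto; rwa [φ0] at this
  let V : Set ℝ := {t | y t = y t₀ + φ t ^ 2 ∧ ψ (φ t) = t ∧
    g (ψ (φ t)) = g₀ (φ t ^ 2) + φ t • g₁ (φ t ^ 2) ∧
    F (ψ (φ t)) = F₀ (φ t ^ 2) + φ t • F₁ (φ t ^ 2)}
  have hVn : V ∈ 𝓝 t₀ := by
    filter_upwards [hφ, lψ, hφt.eventually heg, hφt.eventually heF] with t h1 h2 h3 h4
    exact ⟨h1, h2, h3, h4⟩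
  have hV := eventually_fibre_mem hycont py (c := m) (V := V) fun θ hθ => by
    obtain ⟨k, rfl⟩ := hfib θ hθ
    exact ⟨k, by rw [add_sub_cancel_right]; exact hVn⟩
  have hne : ∀ᶠ c in 𝓝 m, g₁ (c - m) ≠ 0 := by
    have ha := AnalyticAt.comp (g := g₁) (f := fun c : ℝ => c - m) (x := m) (by simpa using ag₁)
      (by fun_prop)
    exact ha.continuousAt.eventually_ne (by simpa using hg₁0)
  filter_upwards [hV, hne] with c' hc' hne' θ hθ
  obtain ⟨k, h1, h2, h3, h4⟩ := hc' θ hθ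
  have hyk : y (θ - k) = c' := by
    rw [← hθ, ← periodic_add_int py (θ - k) k, sub_add_cancel]
  have hgk : g θ = g (θ - k) := by rw [← periodic_add_int pg (θ - k) k, sub_add_cancel]
  have hFk : F θ = F (θ - k) := by rw [← periodic_add_int pF (θ - k) k, sub_add_cancel]
  have hs : φ (θ - k) ^ 2 = c' - m := by rw [← hyk, h1, yt₀]; ring
  rw [h2, hs] at h3 h4
  have hb : g₁ (c' - m) • b c' = F₁ (c' - m) := by
    simp only [b]; rw [smul_smul, mul_inv_cancel₀ hne', one_smul]
  rw [hgk, hFk, h3, h4, ← hb]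
  simp only [smul_eq_mul, add_smul, mul_smul]
  abel

/-- Affine interpolation along the fibres of `y`: an analytic function on the circle is an affine
function of `g` on each fibre of `y`, with coefficients depending analytically on the fibre. -/
theorem exists_interp [CompleteSpace E] {y g : ℝ → ℝ} {F : ℝ → E} (hy : ∀ θ, AnalyticAt ℝ y θ)
    (hg : ∀ θ, AnalyticAt ℝ g θ) (hF : ∀ θ, AnalyticAt ℝ F θ) (py : Function.Periodic y 1)
    (pg : Function.Periodic g 1) (pF : Function.Periodic F 1)
    (hsep : ∀ θ θ', y θ = y θ' → g θ = g θ' → ∃ k : ℤ, θ' = θ + k)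
    (himm : ∀ θ, deriv y θ = 0 → deriv g θ ≠ 0)
    (hnd : ∀ θ, deriv y θ = 0 → deriv (deriv y) θ ≠ 0)
    {m M : ℝ} (H : TwoFold y m M) :
    ∃ a b : ℝ → E, (∀ c ∈ Icc m M, AnalyticAt ℝ a c ∧ AnalyticAt ℝ b c) ∧
      ∀ θ, F θ = a (y θ) + g θ • b (y θ) := by
  have hloc : ∀ c ∈ Icc m M, ∃ a b : ℝ → E, AnalyticAt ℝ a c ∧ AnalyticAt ℝ b c ∧
      ∀ᶠ c' in 𝓝 c, ∀ θ, y θ = c' → F θ = a c' + g θ • b c' := by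
    intro c hc
    rcases hc.1.eq_or_lt with rfl | h1
    · exact interp_local_min hy hg hF py pg pF himm hnd H
    rcases hc.2.eq_or_lt with rfl | h2
    -- The maximum of `y` is the minimum of `-y`.
    · have hdn : deriv (fun θ => -y θ) = fun θ => -deriv y θ := by
        funext θ; exact deriv.fun_neg
      obtain ⟨a, b, ha, hb, hab⟩ := interp_local_min (y := fun θ => -y θ) (fun θ => (hy θ).neg)
        hg hF (fun θ => by simp only [py θ]) pg pF
        (fun θ h => himm θ (by rw [hdn] at h; exact neg_eq_zero.1 h))
        (fun θ h => by
          rw [hdn] at h ⊢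
          rw [deriv.fun_neg]
          exact neg_ne_zero.2 (hnd θ (neg_eq_zero.1 h))) H.neg
      refine ⟨fun c => a (-c), fun c => b (-c),
        AnalyticAt.comp (g := a) (f := fun c : ℝ => -c) ha (by fun_prop),
        AnalyticAt.comp (g := b) (f := fun c : ℝ => -c) hb (by fun_prop), ?_⟩
      have ht : Tendsto (fun c' : ℝ => -c') (𝓝 c) (𝓝 (-c)) := continuous_neg.continuousAt
      filter_upwards [ht.eventually hab] with c' hc' θ hθ
      exact hc' θ (by rw [hθ])
    · exact interp_local_regular hy hg hF py pg pF hsep H ⟨h1, h2⟩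
  choose! A B hA hB hAB using hloc
  have huniq : ∀ c ∈ Ioo m M, ∀ a₁ b₁ a₂ b₂ : E, (∀ θ, y θ = c → F θ = a₁ + g θ • b₁) →
      (∀ θ, y θ = c → F θ = a₂ + g θ • b₂) → a₁ = a₂ ∧ b₁ = b₂ := by
    intro c hc a₁ b₁ a₂ b₂ h1 h2
    obtain ⟨p, q, yp, yq, hpq, -⟩ := H.two c hc
    have hne : g p - g q ≠ 0 := fun h => by
      obtain ⟨k, hk⟩ := hsep p q (yp.trans yq.symm) (sub_eq_zero.1 h)
      exact hpq k hk
    have ep := (h1 p yp).symm.trans (h2 p yp)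
    have eq := (h1 q yq).symm.trans (h2 q yq)
    have hb : b₁ = b₂ := by
      have : (g p - g q) • (b₁ - b₂) = 0 := by
        have : (g p - g q) • (b₁ - b₂) = (a₁ + g p • b₁) - (a₁ + g q • b₁)
          - ((a₂ + g p • b₂) - (a₂ + g q • b₂)) := by
          simp only [sub_smul, smul_sub]; abel
        rw [this, ep, eq]; abel
      exact sub_eq_zero.1 ((smul_eq_zero.1 this).resolve_left hne)
    exact ⟨by rw [hb] at ep; exact add_right_cancel ep, hb⟩
  -- Clamping to `[m, M]`. Inside, local solutions agree because the two ends of a fibre determine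
  -- the coefficients; beyond an endpoint, where fibres are empty, the germ at that endpoint is
  -- kept, so the glued functions are analytic at `m` and `M` too.
  let base : ℝ → ℝ := fun c => if c ≤ m then m else if M ≤ c then M else c
  have bm : ∀ c, c ≤ m → base c = m := fun c h => if_pos h
  have bM : ∀ c, M ≤ c → base c = M := fun c h => by
    simp only [base, if_neg (not_le.2 (H.lt.trans_le h)), if_pos h]
  have bI : ∀ c ∈ Ioo m M, base c = c := fun c h => by
    simp only [base, if_neg (not_le.2 h.1), if_neg (not_le.2 h.2)]
  have hbase : ∀ c ∈ Icc m M, base c = c := fun c hc => by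
    rcases hc.1.eq_or_lt with h | h1
    · rw [bm c h.symm.le, h]
    rcases hc.2.eq_or_lt with h | h2
    · rw [bM c h.symm.le, h]
    · exact bI c ⟨h1, h2⟩
  have hIoo : ∀ c₀ ∈ Icc m M, ∀ᶠ c in 𝓝 c₀, c ∈ Ioo m M →
      A (base c) c = A c₀ c ∧ B (base c) c = B c₀ c := fun c₀ hc₀ => by
    filter_upwards [hAB c₀ hc₀] with c hc hcI
    rw [bI c hcI]
    exact huniq c hcI _ _ _ _ (hAB c (Ioo_subset_Icc_self hcI)).self_of_nhds hc
  have hkey : ∀ c₀ ∈ Icc m M, ∀ᶠ c in 𝓝 c₀,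
      A (base c) c = A c₀ c ∧ B (base c) c = B c₀ c := fun c₀ hc₀ => by
    rcases hc₀.1.eq_or_lt with rfl | h1
    · filter_upwards [hIoo _ hc₀, gt_mem_nhds H.lt] with c h hlt
      rcases le_or_gt c m with hcm | hcm
      · rw [bm c hcm]; exact ⟨rfl, rfl⟩
      · exact h ⟨hcm, hlt⟩
    rcases hc₀.2.eq_or_lt with rfl | h2
    · filter_upwards [hIoo _ hc₀, lt_mem_nhds H.lt] with c h hlt
      rcases le_or_gt c₀ c with hcm | hcm
      · rw [bM c hcm]; exact ⟨rfl, rfl⟩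
      · exact h ⟨hlt, hcm⟩
    · filter_upwards [hIoo _ hc₀, Ioo_mem_nhds h1 h2] with c h hc using h hc
  refine ⟨fun c => A (base c) c, fun c => B (base c) c, fun c hc =>
    ⟨(hA c hc).congr ?_, (hB c hc).congr ?_⟩, fun θ => ?_⟩
  · filter_upwards [hkey c hc] with x hx using hx.1.symm
  · filter_upwards [hkey c hc] with x hx using hx.2.symm
  · simp only [hbase _ (H.mem θ)]
    exact (hAB _ (H.mem θ)).self_of_nhds θ rfl

end Interp

/-! ### Characteristic chords, involutions and orientation of the boundary -/

/-- `ell s lam` as a continuous linear form. -/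
def ellL (s lam : ℝ) : ℝ × ℝ →L[ℝ] ℝ :=
  (s / lam) • ContinuousLinearMap.fst ℝ ℝ ℝ +
    (1 / Real.sqrt (1 - lam ^ 2)) • ContinuousLinearMap.snd ℝ ℝ ℝ

theorem ellL_apply (s lam : ℝ) (x : ℝ × ℝ) : ellL s lam x = ell s lam x := by
  simp [ellL, ell]; ring

theorem sqrt_pos_of_mem {lam : ℝ} (hlam : lam ∈ Ioo (0 : ℝ) 1) : 0 < Real.sqrt (1 - lam ^ 2) :=
  Real.sqrt_pos.2 (by nlinarith [hlam.1, hlam.2])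

theorem ell_vecL_neg {s lam : ℝ} (hlam : lam ∈ Ioo (0 : ℝ) 1) (hs : s = 1 ∨ s = -1) :
    ell s lam (vecL (-s) lam) = 0 ∧ ell (-s) lam (vecL (-s) lam) = 1 := by
  have h1 := hlam.1.ne'
  have h2 := (sqrt_pos_of_mem hlam).ne'
  rcases hs with rfl | rfl <;> simp only [ell, vecL] <;> constructor <;> field_simp <;> norm_num

theorem ell_injective {s lam : ℝ} (hlam : lam ∈ Ioo (0 : ℝ) 1) (hs : s = 1 ∨ s = -1)
    {x y : ℝ × ℝ} (h1 : ell s lam x = ell s lam y) (h2 : ell (-s) lam x = ell (-s) lam y) :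
    x = y := by
  have hl := hlam.1.ne'
  have hr := (sqrt_pos_of_mem hlam).ne'
  have hs0 : s ≠ 0 := by rcases hs with rfl | rfl <;> norm_num
  simp only [ell] at h1 h2
  have e2 : x.2 / Real.sqrt (1 - lam ^ 2) = y.2 / Real.sqrt (1 - lam ^ 2) := by
    have : -s * x.1 / lam = -(s * x.1 / lam) := by ring
    have : -s * y.1 / lam = -(s * y.1 / lam) := by ring
    linarith
  have e1 : s * x.1 / lam = s * y.1 / lam := by linarith
  rw [div_left_inj' hr] at e2
  rw [div_left_inj' hl] at e1
  exact Prod.ext (mul_left_cancel₀ hs0 e1) e2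

section Curve

variable {Ω : Set (ℝ × ℝ)} {z : ℝ → ℝ × ℝ} {lam s : ℝ}

theorem IsDirectParametrization.eq_iff (hz : IsDirectParametrization Ω z) {θ θ' : ℝ}
    (h : z θ = z θ') : ∃ k : ℤ, θ' = θ + k := by
  have hfr : ∀ x : ℝ, z (Int.fract x) = z x := fun x => by
    rw [← periodic_add_int hz.periodic (Int.fract x) ⌊x⌋, Int.fract_add_floor]
  have := hz.injOn ⟨Int.fract_nonneg θ, Int.fract_lt_one θ⟩
    ⟨Int.fract_nonneg θ', Int.fract_lt_one θ'⟩ (by rw [hfr, hfr, h])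
  refine ⟨⌊θ'⌋ - ⌊θ⌋, ?_⟩
  push_cast
  linarith [Int.fract_add_floor θ, Int.fract_add_floor θ']

theorem hasDerivAt_ell {γ : ℝ → ℝ × ℝ} {v : ℝ × ℝ} {t : ℝ} (h : HasDerivAt γ v t) :
    HasDerivAt (fun t => ell s lam (γ t)) (ell s lam v) t := by
  have := (ellL s lam).hasFDerivAt.comp_hasDerivAt t h
  simp only [ellL_apply] at this
  refine this.congr_of_eventuallyEq (Eventually.of_forall fun t => ?_)
  simp [ellL_apply]

theorem analyticAt_ell {γ : ℝ → ℝ × ℝ} {t : ℝ} (h : AnalyticAt ℝ γ t) :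
    AnalyticAt ℝ (fun t => ell s lam (γ t)) t := by
  have := (ContinuousLinearMap.analyticAt (ellL s lam) (γ t)).comp h
  refine this.congr (Eventually.of_forall fun t => ?_)
  simp [ellL_apply]

theorem IsDirectParametrization.deriv_ell (hz : IsDirectParametrization Ω z) (θ : ℝ) :
    deriv (fun t => ell s lam (z t)) θ = ell s lam (deriv z θ) :=
  (hasDerivAt_ell (hz.analytic θ).differentiableAt.hasDerivAt).deriv

theorem IsDirectParametrization.periodic_ell (hz : IsDirectParametrization Ω z) :
    Function.Periodic (fun t => ell s lam (z t)) 1 := fun t => by simp only [hz.periodic t]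

theorem IsDirectParametrization.immersion (hz : IsDirectParametrization Ω z)
    (hlam : lam ∈ Ioo (0 : ℝ) 1) (hs : s = 1 ∨ s = -1) (θ : ℝ)
    (h : deriv (fun t => ell s lam (z t)) θ = 0) : deriv (fun t => ell (-s) lam (z t)) θ ≠ 0 := by
  rw [hz.deriv_ell] at h ⊢
  intro h'
  have h0 : ∀ s, ell s lam 0 = 0 := fun s => by simp [ell]
  exact hz.deriv_ne_zero θ (ell_injective hlam hs (by rw [h, h0]) (by rw [h', h0]))

theorem IsDirectParametrization.separates (hz : IsDirectParametrization Ω z)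
    (hlam : lam ∈ Ioo (0 : ℝ) 1) (hs : s = 1 ∨ s = -1) (θ θ' : ℝ)
    (h : ell s lam (z θ) = ell s lam (z θ')) (h' : ell (-s) lam (z θ) = ell (-s) lam (z θ')) :
    ∃ k : ℤ, θ' = θ + k :=
  hz.eq_iff (ell_injective hlam hs h h')

/-- A ray starting in a bounded set meets the frontier. -/
theorem exists_mem_frontier_ray (hb : Bornology.IsBounded Ω) {x u : ℝ × ℝ} (hx : x ∈ Ω)
    (hu : u ≠ 0) : ∃ t : ℝ, 0 ≤ t ∧ x + t • u ∈ frontier Ω := by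
  have hc : IsPreconnected ((fun t : ℝ => x + t • u) '' Ici 0) :=
    isPreconnected_Ici.image _ (by fun_prop)
  obtain ⟨C, hC⟩ := hb.exists_norm_le
  have hun : 0 < ‖u‖ := norm_pos_iff.2 hu
  have hC0 : 0 ≤ C := (norm_nonneg _).trans (hC x hx)
  set T := (C + ‖x‖ + 1) / ‖u‖ with hT
  have hT0 : 0 ≤ T := by positivity
  have hout : x + T • u ∉ Ω := fun h => by
    have h1 := hC _ h
    have h2 : ‖T • u‖ = C + ‖x‖ + 1 := by
      rw [norm_smul, Real.norm_of_nonneg hT0, hT]; field_simp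
    have h3 := norm_sub_le (x + T • u) x
    rw [add_sub_cancel_left] at h3
    linarith
  -- A ray avoiding the frontier would be split between the interior and the exterior, both of which
  -- it meets, against its connectedness.
  by_contra! hcon
  have hcov : ∀ t ∈ Ici (0 : ℝ), x + t • u ∈ interior Ω ∨ x + t • u ∈ (closure Ω)ᶜ := fun t ht => by
    by_contra! hnot
    exact hcon t ht ⟨not_not.1 hnot.2, hnot.1⟩
  have h0 : x ∈ interior Ω := by
    have := hcov 0 self_mem_Ici
    rw [zero_smul, add_zero] at this
    exact this.resolve_right fun h => h (subset_closure hx)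
  have hT1 : x + T • u ∈ (closure Ω)ᶜ :=
    (hcov T hT0).resolve_left fun h => hout (interior_subset h)
  obtain ⟨w, -, hw1, hw2⟩ := hc (interior Ω) (closure Ω)ᶜ isOpen_interior isClosed_closure.isOpen_compl
    (by rintro _ ⟨t, ht, rfl⟩; exact hcov t ht) ⟨x, ⟨0, self_mem_Ici, by simp⟩, h0⟩
    ⟨_, ⟨T, hT0, rfl⟩, hT1⟩
  exact hw2 (interior_subset_closure hw1)

theorem ell_add_smul (x u : ℝ × ℝ) (t : ℝ) :
    ell s lam (x + t • u) = ell s lam x + t * ell s lam u := by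
  simp only [← ellL_apply, map_add, map_smul, smul_eq_mul]

theorem vecL_ne_zero (hlam : lam ∈ Ioo (0 : ℝ) 1) (s : ℝ) : vecL s lam ≠ 0 := fun h => by
  have h2 : Real.sqrt (1 - lam ^ 2) / 2 = 0 := congrArg Prod.snd h
  have := sqrt_pos_of_mem hlam
  linarith

/-- Moving along the kernel of `ell s` from an interior point reaches the boundary without changing
`ell s`. -/
theorem ell_mem_Icc_of_mem_closure (hb : Bornology.IsBounded Ω) (ho : IsOpen Ω)
    (hz : IsDirectParametrization Ω z)
    (hlam : lam ∈ Ioo (0 : ℝ) 1) (hs : s = 1 ∨ s = -1) {m M : ℝ}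
    (H : TwoFold (fun t => ell s lam (z t)) m M) {x : ℝ × ℝ} (hx : x ∈ closure Ω) :
    ell s lam x ∈ Icc m M := by
  have hfr : ∀ y ∈ frontier Ω, ell s lam y ∈ Icc m M := fun y hy => by
    rw [← hz.range_eq] at hy
    obtain ⟨θ, rfl⟩ := hy
    exact H.mem θ
  by_cases hxΩ : x ∈ Ω
  · obtain ⟨t, -, ht⟩ := exists_mem_frontier_ray hb hxΩ (vecL_ne_zero hlam (-s))
    have := hfr _ ht
    rwa [ell_add_smul, (ell_vecL_neg hlam hs).1, mul_zero, add_zero] at this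
  · exact hfr x ⟨hx, by rwa [ho.interior_eq]⟩

/-- At the endpoint of a chord `ell s = const` where `ell (-s)` is larger, the direct orientation
of the boundary determines the sign of the derivative of `ell s`. -/
theorem sign_deriv_ell (hb : Bornology.IsBounded Ω) (ho : IsOpen Ω)
    (han : HasAnalyticBoundary Ω) (hz : IsDirectParametrization Ω z)
    (hlam : lam ∈ Ioo (0 : ℝ) 1) (hs : s = 1 ∨ s = -1) {m M : ℝ}
    (H : TwoFold (fun t => ell s lam (z t)) m M) {p q : ℝ}
    (hp : ell s lam (z p) ∈ Ioo m M) (hpq : ell s lam (z p) = ell s lam (z q))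
    (hlt : ell (-s) lam (z q) < ell (-s) lam (z p)) :
    s * deriv (fun t => ell s lam (z t)) p < 0 := by
  set u := vecL (-s) lam with hu
  obtain ⟨hu0, hu1⟩ := ell_vecL_neg hlam hs
  -- A boundary point beyond `z p` would be a third point on the chord, whose only boundary points
  -- are `z p` and the lower end `z q`.
  have hnofr : ∀ t : ℝ, 0 < t → z p + t • u ∉ frontier Ω := by
    intro t ht hfr
    rw [← hz.range_eq] at hfr
    obtain ⟨θ, hθ⟩ := hfr
    have e0 : ell s lam (z θ) = ell s lam (z p) := by
      rw [hθ, ell_add_smul, hu0]; ring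
    have e1 : ell (-s) lam (z θ) = ell (-s) lam (z p) + t := by
      rw [hθ, ell_add_smul, hu1]; ring
    obtain ⟨p', q', -, -, -, hfib⟩ := H.two _ hp
    have hzk : ∀ a : ℝ, ∀ k : ℤ, z (a + k) = z a := fun a k => periodic_add_int hz.periodic a k
    have hp' := hfib p rfl
    have hq' := hfib q hpq.symm
    have hθ' := hfib θ e0
    rcases hp' with ⟨k1, hk1⟩ | ⟨k1, hk1⟩ <;> rcases hq' with ⟨k2, hk2⟩ | ⟨k2, hk2⟩ <;>
      rcases hθ' with ⟨k3, hk3⟩ | ⟨k3, hk3⟩ <;>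
      simp only [hk1, hk2, hk3, hzk] at e1 hlt <;> linarith
  -- From a point of `Ω` beyond `z p`, the ray would meet the frontier again, still beyond `z p`.
  have hnot : ∀ t : ℝ, 0 < t → z p + t • u ∉ Ω := by
    intro t ht hΩ
    obtain ⟨t', ht', hfr⟩ := exists_mem_frontier_ray hb hΩ (vecL_ne_zero hlam (-s))
    rw [add_assoc, ← add_smul] at hfr
    exact hnofr (t + t') (by linarith) hfr
  have hfrp : z p ∈ frontier Ω := by rw [← hz.range_eq]; exact mem_range_self p
  obtain ⟨φ, aφ, φ0, dφ, hφ⟩ := han _ hfrp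
  have hzd := (hz.analytic p).differentiableAt.hasDerivAt
  have hDφ := aφ.differentiableAt.hasFDerivAt
  -- the defining function vanishes along the boundary
  have hφz : ∀ᶠ t in 𝓝 p, φ (z t) = 0 := by
    have hct : Tendsto z (𝓝 p) (𝓝 (z p)) := (hz.analytic p).continuousAt
    filter_upwards [hct.eventually hφ.eventually_nhds, hct.eventually aφ.eventually_analyticAt]
      with t ht hat
    have hfr : z t ∈ frontier Ω := by rw [← hz.range_eq]; exact mem_range_self t
    have hnΩ : z t ∉ Ω := by
      have := hfr.2
      rwa [ho.interior_eq] at this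
    refine le_antisymm ?_ (not_lt.1 fun h => hnΩ (ht.self_of_nhds.2 h))
    by_contra hpos
    have hev := hat.continuousAt.eventually (lt_mem_nhds (not_le.1 hpos))
    obtain ⟨w, ⟨h1, h2⟩, h3⟩ := mem_closure_iff_nhds.1 hfr.1 _ (ht.and hev)
    exact lt_asymm h2 (h1.1 h3)
  have hφt : fderiv ℝ φ (z p) (deriv z p) = 0 := by
    have h1 := hDφ.comp_hasDerivAt p hzd
    have h2 : HasDerivAt (φ ∘ z) 0 p := (hasDerivAt_const p (0 : ℝ)).congr_of_eventuallyEq hφz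
    exact h1.unique h2
  -- sign of a directional derivative
  have hline : ∀ v : ℝ × ℝ,
      HasDerivAt (fun ε : ℝ => φ (z p + ε • v)) (fderiv ℝ φ (z p) v) 0 := fun v => by
    have h1 : HasDerivAt (fun ε : ℝ => z p + ε • v) v 0 := by
      simpa using ((hasDerivAt_id (0 : ℝ)).smul_const v).const_add (z p)
    refine HasFDerivAt.comp_hasDerivAt (0 : ℝ) (l := φ) ?_ h1
    simpa using hDφ
  have hlim : ∀ v : ℝ × ℝ, Tendsto (fun ε : ℝ => ε⁻¹ * φ (z p + ε • v)) (𝓝[>] 0)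
      (𝓝 (fderiv ℝ φ (z p) v)) := fun v => by
    have h1 := ((hline v).tendsto_slope).mono_left (nhdsWithin_mono 0 fun x (hx : 0 < x) => hx.ne')
    refine h1.congr fun ε => ?_
    simp [slope_def_field, φ0, div_eq_inv_mul]
  have hnear : ∀ v : ℝ × ℝ, ∀ᶠ ε : ℝ in 𝓝[>] 0,
      (z p + ε • v ∈ Ω ↔ φ (z p + ε • v) < 0) := fun v => by
    have hct : Tendsto (fun ε : ℝ => z p + ε • v) (𝓝 0) (𝓝 (z p)) := by
      have : ContinuousAt (fun ε : ℝ => z p + ε • v) 0 := by fun_prop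
      simpa using this.tendsto
    exact (hct.mono_left nhdsWithin_le_nhds).eventually hφ
  have hn_le : fderiv ℝ φ (z p) (rotJ (deriv z p)) ≤ 0 := by
    refine le_of_tendsto (hlim _) ?_
    filter_upwards [hz.direct p, hnear (rotJ (deriv z p)), self_mem_nhdsWithin] with ε h1 h2 h3
    exact mul_nonpos_of_nonneg_of_nonpos (inv_nonneg.2 (le_of_lt h3)) (h2.1 h1).le
  -- The direction `u` leaves `Ω` while the rotated tangent enters it; comparing both through `φ`
  -- gives the sign of the cross product of the tangent with `u`.
  have hu_ge : 0 ≤ fderiv ℝ φ (z p) u := by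
    refine ge_of_tendsto (hlim _) ?_
    filter_upwards [hnear u, self_mem_nhdsWithin] with ε h2 h3
    exact mul_nonneg (inv_nonneg.2 (le_of_lt h3))
      (not_lt.1 fun h => hnot ε h3 (h2.2 h))
  -- decomposition in the frame given by the tangent and the normal
  set v := deriv z p with hv
  have hvne : v ≠ 0 := hz.deriv_ne_zero p
  have hN : 0 < v.1 ^ 2 + v.2 ^ 2 := by
    rcases eq_or_ne v.1 0 with h1 | h1
    · have h2 : v.2 ≠ 0 := fun h2 => hvne (Prod.ext h1 h2)
      positivity
    · positivity
  have hdec : ∀ w : ℝ × ℝ, (v.1 ^ 2 + v.2 ^ 2) • w =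
      (v.1 * w.1 + v.2 * w.2) • v + (v.1 * w.2 - v.2 * w.1) • rotJ v := fun w => by
    ext <;> simp [rotJ] <;> ring
  have hDdec : ∀ w : ℝ × ℝ, (v.1 ^ 2 + v.2 ^ 2) * fderiv ℝ φ (z p) w =
      (v.1 * w.2 - v.2 * w.1) * fderiv ℝ φ (z p) (rotJ v) := fun w => by
    have := congrArg (fderiv ℝ φ (z p)) (hdec w)
    simpa [hφt] using this
  have hn_lt : fderiv ℝ φ (z p) (rotJ v) < 0 := by
    refine lt_of_le_of_ne hn_le fun h0 => dφ ?_
    refine ContinuousLinearMap.ext fun w => ?_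
    have := hDdec w
    rw [h0, mul_zero] at this
    simpa using (mul_eq_zero.1 this).resolve_left hN.ne'
  have hcross : v.1 * u.2 - v.2 * u.1 ≤ 0 := by
    by_contra hpos
    have h1 := hDdec u
    have h2 := mul_neg_of_pos_of_neg (not_le.1 hpos) hn_lt
    have h3 := mul_nonneg hN.le hu_ge
    linarith
  have hreg := H.regular p hp
  rw [hz.deriv_ell] at hreg ⊢
  have hρ := sqrt_pos_of_mem hlam
  have hl := hlam.1
  -- This cross product is a positive multiple of `s * ell s lam v`, since `u` spans the kernel of
  -- `ell s`.
  have hid : v.1 * u.2 - v.2 * u.1 =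
      lam * Real.sqrt (1 - lam ^ 2) / 2 * (s * ell s lam v) := by
    have h2 : s * s = 1 := by rcases hs with rfl | rfl <;> norm_num
    simp only [hu, vecL, ell]
    field_simp
    linear_combination (-v.1 * Real.sqrt (1 - lam ^ 2)) * h2
  have hs0 : s ≠ 0 := by rcases hs with rfl | rfl <;> norm_num
  refine lt_of_le_of_ne ?_ (mul_ne_zero hs0 hreg)
  by_contra hpos
  rw [hid] at hcross
  have : 0 < lam * Real.sqrt (1 - lam ^ 2) / 2 := by positivity
  have := mul_pos this (not_le.1 hpos)
  linarith

theorem ell_gam (x : ℝ × ℝ) : ell s lam (gam Ω s lam x) = ell s lam x := by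
  unfold gam
  split_ifs with h
  · exact h.choose_spec.2.1
  · rfl

theorem gam_eq (hz : IsDirectParametrization Ω z) {m M : ℝ}
    (H : TwoFold (fun t => ell s lam (z t)) m M) {p q : ℝ} (hp : ell s lam (z p) ∈ Ioo m M)
    (hpq : ell s lam (z q) = ell s lam (z p)) (hne : z q ≠ z p) : gam Ω s lam (z p) = z q := by
  have hex : ∃ y ∈ frontier Ω, ell s lam y = ell s lam (z p) ∧ y ≠ z p :=
    ⟨z q, by rw [← hz.range_eq]; exact mem_range_self q, hpq, hne⟩
  unfold gam
  rw [dif_pos hex]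
  obtain ⟨h1, h2, h3⟩ := hex.choose_spec
  obtain ⟨θ, hθ⟩ : hex.choose ∈ range z := (Set.ext_iff.1 hz.range_eq _).2 h1
  rw [← hθ] at h2 h3 ⊢
  obtain ⟨p', q', -, -, -, hfib⟩ := H.two _ hp
  have hzk : ∀ a : ℝ, ∀ k : ℤ, z (a + k) = z a := fun a k => periodic_add_int hz.periodic a k
  rcases hfib p rfl with ⟨k1, hk1⟩ | ⟨k1, hk1⟩ <;>
    rcases hfib q hpq with ⟨k2, hk2⟩ | ⟨k2, hk2⟩ <;>
    rcases hfib θ h2 with ⟨k3, hk3⟩ | ⟨k3, hk3⟩ <;>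
    simp_all

theorem gam_eq_self (hz : IsDirectParametrization Ω z) {c p : ℝ}
    (hp : ell s lam (z p) = c)
    (huniq : ∃ p, ∀ θ, ell s lam (z θ) = c → ∃ k : ℤ, θ = p + k) : gam Ω s lam (z p) = z p := by
  unfold gam
  refine dif_neg ?_
  rintro ⟨y, hy, h2, h3⟩
  rw [← hz.range_eq] at hy
  obtain ⟨θ, rfl⟩ := hy
  obtain ⟨p', hp'⟩ := huniq
  obtain ⟨k1, hk1⟩ := hp' p hp
  obtain ⟨k2, hk2⟩ := hp' θ (h2.trans hp)
  apply h3
  rw [hk1, hk2, periodic_add_int hz.periodic, periodic_add_int hz.periodic]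

/-- The choice in the definition is harmless: two parameters of one point differ by an integer, and
`z' ≠ 0` fixes the coefficient. -/
theorem curveDifferential_smul (hz : IsDirectParametrization Ω z) (g : ℝ × ℝ → ℝ × ℝ) (q c : ℝ) :
    curveDifferential z g (z q) (c • deriv z q) = c • deriv (fun t => g (z t)) q := by
  have hex : ∃ p : ℝ × ℝ, z p.1 = z q ∧ p.2 • deriv z p.1 = c • deriv z q := ⟨(q, c), rfl, rfl⟩
  unfold curveDifferential
  rw [dif_pos hex]
  obtain ⟨h1, h2⟩ := hex.choose_spec
  obtain ⟨k, hk⟩ := hz.eq_iff h1.symm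
  have hder : ∀ {f : ℝ → ℝ × ℝ}, Function.Periodic f 1 → deriv f (q + k) = deriv f q := by
    intro f hf
    have hp : Function.Periodic (deriv f) 1 := fun x => by
      rw [← deriv_comp_add_const]
      exact congrArg (fun g => deriv g x) (funext hf)
    exact periodic_add_int hp q k
  rw [hk, hder hz.periodic] at h2
  have hc : hex.choose.2 = c := smul_left_injective ℝ (hz.deriv_ne_zero q) h2
  rw [hk, hc, hder fun x => by simp only [hz.periodic x]]

/-- Near `q` the involution reads `z ∘ r ∘ y`, where `r` is the local inverse of `y = ell s ∘ z` at
the opposite end `p`. -/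
theorem differentiableAt_gam (hz : IsDirectParametrization Ω z) {m M : ℝ}
    (H : TwoFold (fun t => ell s lam (z t)) m M) {p q : ℝ} (hp : ell s lam (z p) ∈ Ioo m M)
    (hpq : ell s lam (z q) = ell s lam (z p)) (hne : z q ≠ z p) :
    DifferentiableAt ℝ (fun t => gam Ω s lam (z t)) q := by
  obtain ⟨r, ar, r0, hr, -⟩ := exists_local_inverse
    (analyticAt_ell (s := s) (lam := lam) (hz.analytic p)) (H.regular p hp)
  have hyq : ContinuousAt (fun t => ell s lam (z t)) q :=
    (analyticAt_ell (hz.analytic q)).continuousAt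
  have hyt : Tendsto (fun t => ell s lam (z t)) (𝓝 q) (𝓝 (ell s lam (z p))) := by
    rw [← hpq]; exact hyq
  have ac : AnalyticAt ℝ (fun t => z (r (ell s lam (z t)))) q := by
    refine AnalyticAt.comp (g := z) (f := fun t => r (ell s lam (z t))) (hz.analytic _) ?_
    exact AnalyticAt.comp (g := r) (f := fun t => ell s lam (z t)) (by rwa [hpq])
      (analyticAt_ell (hz.analytic q))
  have hval : z (r (ell s lam (z q))) = z p := by rw [hpq, r0]
  have hne' : ∀ᶠ t in 𝓝 q, z (r (ell s lam (z t))) ≠ z t :=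
    (ContinuousAt.ne_iff_eventually_ne ac.continuousAt (hz.analytic q).continuousAt).1
      (by rw [hval]; exact hne.symm)
  refine ac.differentiableAt.congr_of_eventuallyEq ?_
  filter_upwards [hne', hyt.eventually hr, hyt.eventually (Ioo_mem_nhds hp.1 hp.2)] with t h1 h2 h3
  exact gam_eq hz H h3 h2 h1

/-- Since `ell s ∘ gam = ell s`, the differential of the involution disappears after applying `ell
s`; only its existence matters. -/
theorem ell_fieldY (hz : IsDirectParametrization Ω z) {m M : ℝ}
    (H : TwoFold (fun t => ell s lam (z t)) m M) {X : ℝ × ℝ → ℝ × ℝ} {h : ℝ → ℝ}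
    (hX : ∀ θ, X (z θ) = h θ • deriv z θ) {p q : ℝ} (hp : ell s lam (z p) ∈ Ioo m M)
    (hpq : ell s lam (z q) = ell s lam (z p)) (hne : z q ≠ z p) :
    ell s lam (fieldY Ω z lam X s (z p)) =
      h p * deriv (fun t => ell s lam (z t)) p - h q * deriv (fun t => ell s lam (z t)) q := by
  have hd := hasDerivAt_ell (s := s) (lam := lam)
    (differentiableAt_gam hz H hp hpq hne).hasDerivAt
  simp only [ell_gam] at hd
  unfold fieldY
  rw [gam_eq hz H hp hpq hne, hX q, hX p, curveDifferential_smul hz, hd.deriv, hz.deriv_ell]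
  simp only [← ellL_apply, map_sub, map_smul, smul_eq_mul]

/-- A critical point is fixed by the involution, so vanishing of `X` there would make `Y` vanish. -/
theorem field_ne_zero_of_critical (hz : IsDirectParametrization Ω z) {m M : ℝ}
    (H : TwoFold (fun t => ell s lam (z t)) m M) {X : ℝ × ℝ → ℝ × ℝ} {h : ℝ → ℝ}
    (hX : ∀ θ, X (z θ) = h θ • deriv z θ) {p : ℝ} {c : ℝ} (hc : c ≠ 0)
    (hY : fieldY Ω z lam X s (z p) = c • deriv z p)
    (hp : deriv (fun t => ell s lam (z t)) p = 0) : h p ≠ 0 := by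
  intro h0
  have hg : gam Ω s lam (z p) = z p := by
    rcases (H.mem p).1.eq_or_lt with h1 | h1
    · obtain ⟨p', -, hp'⟩ := H.min
      exact gam_eq_self hz h1.symm ⟨p', hp'⟩
    rcases (H.mem p).2.eq_or_lt with h2 | h2
    · obtain ⟨p', -, hp'⟩ := H.max
      exact gam_eq_self hz h2 ⟨p', hp'⟩
    · exact absurd hp (H.regular p ⟨h1, h2⟩)
  unfold fieldY at hY
  rw [hg, hX p, curveDifferential_smul hz, h0, zero_smul, zero_smul, sub_zero] at hY
  exact (smul_ne_zero hc (hz.deriv_ne_zero p)) hY.symm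

end Curve

/-! ### Uniqueness of the interpolation and positivity of its slope -/

section Interp

variable {E : Type*} [NormedAddCommGroup E] [NormedSpace ℝ E]

theorem TwoFold.Icc_subset_closure {y : ℝ → ℝ} {m M : ℝ} (H : TwoFold y m M) :
    Icc m M ⊆ closure (Ioo m M) := by rw [closure_Ioo H.lt.ne]

/-- The coefficients of the affine interpolation of the zero function vanish. -/
theorem interp_zero {y g : ℝ → ℝ} {m M : ℝ} (H : TwoFold y m M)
    (hsep : ∀ θ θ', y θ = y θ' → g θ = g θ' → ∃ k : ℤ, θ' = θ + k) {a b : ℝ → E}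
    (ha : ∀ c ∈ Icc m M, ContinuousAt a c) (hb : ∀ c ∈ Icc m M, ContinuousAt b c)
    (h : ∀ θ, a (y θ) + g θ • b (y θ) = 0) : ∀ c ∈ Icc m M, a c = 0 ∧ b c = 0 := by
  have hI : ∀ c ∈ Ioo m M, a c = 0 ∧ b c = 0 := by
    intro c hc
    obtain ⟨p, q, yp, yq, hpq, -⟩ := H.two c hc
    have hne : g p - g q ≠ 0 := fun h => by
      obtain ⟨k, hk⟩ := hsep p q (yp.trans yq.symm) (sub_eq_zero.1 h)
      exact hpq k hk
    have ep := h p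
    have eq := h q
    rw [yp] at ep
    rw [yq] at eq
    have hb0 : b c = 0 := by
      have : (g p - g q) • b c = 0 := by
        rw [sub_smul, ← add_sub_add_left_eq_sub (g p • b c) (g q • b c) (a c), ep, eq, sub_zero]
      exact (smul_eq_zero.1 this).resolve_left hne
    exact ⟨by simpa [hb0] using ep, hb0⟩
  have key : ∀ f : ℝ → E, (∀ c ∈ Icc m M, ContinuousAt f c) → (∀ c ∈ Ioo m M, f c = 0) →
      ∀ c ∈ Icc m M, f c = 0 := fun f hf h0 c hc => by
    have : (𝓝[Ioo m M] c).NeBot := mem_closure_iff_nhdsWithin_neBot.1 (H.Icc_subset_closure hc)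
    refine tendsto_nhds_unique (l := 𝓝[Ioo m M] c) ((hf c hc).tendsto.mono_left nhdsWithin_le_nhds) ?_
    exact tendsto_const_nhds.congr' (by
      filter_upwards [self_mem_nhdsWithin] with x hx using (h0 x hx).symm)
  exact fun c hc => ⟨key a ha (fun c hc => (hI c hc).1) c hc, key b hb (fun c hc => (hI c hc).2) c hc⟩

/-- Positivity of the slope of the affine interpolation of `h y'`. -/
theorem interp_slope_pos {y g h : ℝ → ℝ} {m M : ℝ} (H : TwoFold y m M)
    (hy : ∀ θ, AnalyticAt ℝ y θ) (hg : ∀ θ, DifferentiableAt ℝ g θ)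
    (hh : ∀ θ, DifferentiableAt ℝ h θ)
    (hsep : ∀ θ θ', y θ = y θ' → g θ = g θ' → ∃ k : ℤ, θ' = θ + k)
    (hnd : ∀ θ, deriv y θ = 0 → deriv (deriv y) θ ≠ 0)
    (hpos : ∀ p q, y p ∈ Ioo m M → y q = y p → g q < g p →
      0 < h p * deriv y p - h q * deriv y q)
    (hne : ∀ p, deriv y p = 0 → h p ≠ 0) {a b : ℝ → ℝ}
    (ha : ∀ c ∈ Icc m M, DifferentiableAt ℝ a c) (hb : ∀ c ∈ Icc m M, DifferentiableAt ℝ b c)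
    (hab : ∀ θ, h θ * deriv y θ = a (y θ) + g θ * b (y θ)) : ∀ c ∈ Icc m M, 0 < b c := by
  have hI : ∀ c ∈ Ioo m M, 0 < b c := by
    have key : ∀ p q, y p ∈ Ioo m M → y q = y p → g q < g p → 0 < b (y p) := by
      intro p q hp hq hlt
      have h1 := hpos p q hp hq hlt
      rw [hab p, hab q, hq] at h1
      have h2 : 0 < (g p - g q) * b (y p) := by linarith
      exact (pos_iff_pos_of_mul_pos h2).1 (sub_pos.2 hlt)
    intro c hc
    obtain ⟨p, q, yp, yq, hpq, -⟩ := H.two c hc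
    have hne : g p ≠ g q := fun h => by
      obtain ⟨k, hk⟩ := hsep p q (yp.trans yq.symm) h
      exact hpq k hk
    rcases hne.lt_or_gt with h | h
    · rw [← yq]; exact key q p (by rwa [yq]) (yp.trans yq.symm) h
    · rw [← yp]; exact key p q (by rwa [yp]) (yq.trans yp.symm) h
  have hge : ∀ c ∈ Icc m M, 0 ≤ b c := fun c hc => by
    have : (𝓝[Ioo m M] c).NeBot := mem_closure_iff_nhdsWithin_neBot.1 (H.Icc_subset_closure hc)
    refine ge_of_tendsto ((hb c hc).continuousAt.tendsto.mono_left
      (nhdsWithin_le_nhds (s := Ioo m M))) ?_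
    filter_upwards [self_mem_nhdsWithin] with x hx using (hI x hx).le
  -- Differentiating `h y' = a(y) + g b(y)` at a critical point leaves `h y'' = g' b(y)`, whose left
  -- side is nonzero.
  have hcrit : ∀ p, deriv y p = 0 → b (y p) ≠ 0 := by
    intro p hp h0
    have hyd := (hy p).differentiableAt.hasDerivAt
    have h1 : HasDerivAt (fun θ => h θ * deriv y θ)
        (deriv h p * deriv y p + h p * deriv (deriv y) p) p :=
      (hh p).hasDerivAt.mul (hy p).deriv.differentiableAt.hasDerivAt
    have h2 : HasDerivAt (fun θ => a (y θ) + g θ * b (y θ))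
        (deriv a (y p) * deriv y p + (deriv g p * b (y p) + g p * (deriv b (y p) * deriv y p))) p :=
      ((ha _ (H.mem p)).hasDerivAt.comp p hyd).add
        ((hg p).hasDerivAt.mul ((hb _ (H.mem p)).hasDerivAt.comp p hyd))
    rw [← funext hab] at h2
    have h3 := h1.unique h2
    rw [hp, h0] at h3
    simp only [mul_zero, zero_add, add_zero] at h3
    exact mul_ne_zero (hne p hp) (hnd p hp) h3
  intro c hc
  have hlast : ∀ p, y p = c → deriv y p = 0 → 0 < b c := fun p hp hd =>
    lt_of_le_of_ne (hge c hc) (by rw [← hp]; exact (hcrit p hd).symm)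
  rcases hc.1.eq_or_lt with h1 | h1
  · obtain ⟨p, hp, -⟩ := H.min
    exact hlast p (hp.trans h1) (IsLocalMin.deriv_eq_zero
      (Eventually.of_forall fun t => by rw [hp]; exact (H.mem t).1))
  rcases hc.2.eq_or_lt with h2 | h2
  · obtain ⟨p, hp, -⟩ := H.max
    exact hlast p (hp.trans h2.symm) (IsLocalMax.deriv_eq_zero
      (Eventually.of_forall fun t => by rw [hp]; exact (H.mem t).2))
  · exact hI c ⟨h1, h2⟩

end Interp

/-! ### Extension of one component to the closed domain -/

theorem escape_sign {Ω : Set (ℝ × ℝ)} {z : ℝ → ℝ × ℝ} {lam s : ℝ} {X : ℝ × ℝ → ℝ × ℝ}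
    (hX : IsEscapeField Ω z lam X) (hs : s = 1 ∨ s = -1) (θ : ℝ) :
    ∃ c : ℝ, s * c < 0 ∧ fieldY Ω z lam X s (z θ) = c • deriv z θ := by
  rcases hs with rfl | rfl
  · obtain ⟨c, hc, h⟩ := hX.plus_negative θ
    exact ⟨c, by linarith, h⟩
  · obtain ⟨c, hc, h⟩ := hX.minus_positive θ
    exact ⟨c, by linarith, h⟩

/-- Extension to the closed domain of the component `ell s` of the deformation, as a function with
values in the space of (rescaled) Taylor coefficients in the time variable. -/
theorem exists_component_extension {Ω : Set (ℝ × ℝ)} (ho : IsOpen Ω)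
    (hb : Bornology.IsBounded Ω) (han : HasAnalyticBoundary Ω) {z : ℝ → ℝ × ℝ}
    (hz : IsDirectParametrization Ω z) {lam : ℝ} (hlam : lam ∈ Ioo (0 : ℝ) 1)
    (hsimple : IsLambdaSimple z lam) {X : ℝ × ℝ → ℝ × ℝ} (hX : IsEscapeField Ω z lam X)
    {h : ℝ → ℝ} (hh : ∀ θ, AnalyticAt ℝ h θ) (hXh : ∀ θ, X (z θ) = h θ • deriv z θ)
    {s : ℝ} (hs : s = 1 ∨ s = -1) {K : ℝ} {F : ℝ → BSeq}
    (hF : ∀ θ, AnalyticAt ℝ F θ) (pF : Function.Periodic F 1)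
    (hF0 : ∀ θ, F θ 0 = (ell s lam (z θ) : ℂ))
    (hF1 : ∀ θ, K * F θ 1 = ((h θ * deriv (fun t => ell s lam (z t)) θ : ℝ) : ℂ)) :
    ∃ G : ℝ × ℝ → BSeq, (∀ x ∈ closure Ω, AnalyticAt ℝ G x) ∧ (∀ θ, G (z θ) = F θ) ∧
      (∀ x ∈ closure Ω, G x 0 = (ell s lam x : ℂ)) ∧
      ∀ x ∈ closure Ω, ∃ r : ℝ, 0 < r ∧ K * (fderiv ℝ G x (vecL (-s) lam)) 1 = (r : ℂ) := by
  set y : ℝ → ℝ := fun t => ell s lam (z t) with hydef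
  set g : ℝ → ℝ := fun t => ell (-s) lam (z t) with hgdef
  have hy : ∀ θ, AnalyticAt ℝ y θ := fun θ => analyticAt_ell (hz.analytic θ)
  have hg : ∀ θ, AnalyticAt ℝ g θ := fun θ => analyticAt_ell (hz.analytic θ)
  obtain ⟨hcard, hnd⟩ := hsimple s (by simpa using hs)
  obtain ⟨m, M, H⟩ := twoFold_of_critical (fun θ => (hy θ).differentiableAt) hz.periodic_ell hcard
  have hsep : ∀ θ θ', y θ = y θ' → g θ = g θ' → ∃ k : ℤ, θ' = θ + k := hz.separates hlam hs
  obtain ⟨a, b, hab, hFab⟩ := exists_interp hy hg hF hz.periodic_ell hz.periodic_ell pF hsep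
    (hz.immersion hlam hs) hnd H
  have hmem : ∀ x ∈ closure Ω, ell s lam x ∈ Icc m M := fun x hx =>
    ell_mem_Icc_of_mem_closure hb ho hz hlam hs H hx
  have hell : ∀ s x, AnalyticAt ℝ (ell s lam) x := fun s x =>
    ((ellL s lam).analyticAt x).congr (Eventually.of_forall (ellL_apply s lam))
  -- coordinates of the coefficients
  have hco : ∀ n θ, F θ n = a (y θ) n + g θ * b (y θ) n := fun n θ => by
    conv_lhs => rw [hFab θ]
    rfl
  have hcoan : ∀ n, ∀ f : ℝ → BSeq, ∀ c, AnalyticAt ℝ f c → AnalyticAt ℝ (fun c => f c n) c :=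
    fun n f c hf => (((coord n).restrictScalars ℝ).analyticAt (f c)).comp hf
  -- The coefficient of order zero of `F` is `y` itself, so uniqueness of the interpolation forces
  -- `a = c`, `b = 0`.
  have hzero : ∀ c ∈ Icc m M, a c 0 = c ∧ b c 0 = 0 := by
    have := interp_zero H hsep (a := fun c => a c 0 - (c : ℂ)) (b := fun c => b c 0)
      (fun c hc => (hcoan 0 a c (hab c hc).1).continuousAt.sub Complex.continuous_ofReal.continuousAt)
      (fun c hc => (hcoan 0 b c (hab c hc).2).continuousAt)
      (fun θ => by
        have h1 := hco 0 θ
        rw [hF0] at h1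
        rw [Complex.real_smul]
        linear_combination -h1)
    exact fun c hc => ⟨sub_eq_zero.1 (this c hc).1, (this c hc).2⟩
  have hone : ∀ θ, ((h θ * deriv y θ : ℝ) : ℂ) = K * a (y θ) 1 + g θ * (K * b (y θ) 1) := fun θ => by
    rw [← hF1 θ, hco 1 θ]; ring
  have hK1 : ∀ f : ℝ → BSeq, ∀ c, AnalyticAt ℝ f c → DifferentiableAt ℝ (fun c => (K : ℂ) * f c 1) c :=
    fun f c hf => (hcoan 1 f c hf).differentiableAt.const_mul _
  have hre : ∀ f : ℝ → ℂ, ∀ c, DifferentiableAt ℝ f c → DifferentiableAt ℝ (fun c => (f c).re) c :=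
    fun f c hf => Complex.reCLM.differentiableAt.comp c hf
  have him : ∀ f : ℝ → ℂ, ∀ c, DifferentiableAt ℝ f c → DifferentiableAt ℝ (fun c => (f c).im) c :=
    fun f c hf => Complex.imCLM.differentiableAt.comp c hf
  -- The imaginary parts interpolate the zero function, as `h y'` is real.
  have hbim : ∀ c ∈ Icc m M, ((K : ℂ) * b c 1).im = 0 := fun c hc =>
    (interp_zero H hsep (a := fun c => ((K : ℂ) * a c 1).im) (b := fun c => ((K : ℂ) * b c 1).im)
      (fun c hc => (him _ c (hK1 a c (hab c hc).1)).continuousAt)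
      (fun c hc => (him _ c (hK1 b c (hab c hc).2)).continuousAt)
      (fun θ => by
        have := congrArg Complex.im (hone θ)
        rw [Complex.ofReal_im, Complex.add_im,
          Complex.im_ofReal_mul (g θ)] at this
        rw [smul_eq_mul]
        exact this.symm) c hc).2
  have hbre : ∀ c ∈ Icc m M, 0 < ((K : ℂ) * b c 1).re := by
    refine interp_slope_pos (a := fun c => ((K : ℂ) * a c 1).re) H hy
      (fun θ => (hg θ).differentiableAt) (fun θ => (hh θ).differentiableAt) hsep hnd ?_ ?_
      (fun c hc => hre _ c (hK1 a c (hab c hc).1)) (fun c hc => hre _ c (hK1 b c (hab c hc).2))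
      (fun θ => ?_)
    · intro p q hp hq hlt
      have hne : z q ≠ z p := fun h => hlt.ne (by simp only [g, h])
      obtain ⟨c, hc, hY⟩ := escape_sign hX hs p
      have h1 := ell_fieldY hz H hXh hp hq hne
      rw [hY] at h1
      have h2 : ell s lam (c • deriv z p) = c * deriv y p := by
        rw [hydef, hz.deriv_ell, ← ellL_apply, map_smul, ellL_apply, smul_eq_mul]
      rw [h2] at h1
      have h3 := sign_deriv_ell hb ho han hz hlam hs H hp hq.symm hlt
      have h4 := mul_pos_of_neg_of_neg hc h3
      have h5 : s * s = 1 := by rcases hs with rfl | rfl <;> norm_num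
      have h6 : s * c * (s * deriv y p) = c * deriv y p := by
        linear_combination (c * deriv y p) * h5
      have h7 : 0 < c * deriv y p := h6 ▸ h4
      exact h1 ▸ h7
    · intro p hp
      obtain ⟨c, hc, hY⟩ := escape_sign hX hs p
      exact field_ne_zero_of_critical hz H hXh (fun h => by simp [h] at hc) hY hp
    · have := congrArg Complex.re (hone θ)
      rwa [Complex.ofReal_re, Complex.add_re,
        Complex.re_ofReal_mul (g θ)] at this
  let G : ℝ × ℝ → BSeq := fun x => a (ell s lam x) + ell (-s) lam x • b (ell s lam x)
  have hGan : ∀ x ∈ closure Ω, AnalyticAt ℝ G x := fun x hx =>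
    ((hab _ (hmem x hx)).1.comp (hell s x)).add
      ((hell (-s) x).smul ((hab _ (hmem x hx)).2.comp (hell s x)))
  refine ⟨G, hGan, fun θ => (hFab θ).symm, fun x hx => ?_, fun x hx => ?_⟩
  · have h1 : G x 0 = a (ell s lam x) 0 + ell (-s) lam x * b (ell s lam x) 0 := rfl
    obtain ⟨h2, h3⟩ := hzero _ (hmem x hx)
    rw [h1, h2, h3, mul_zero, add_zero]
  · obtain ⟨hu0, hu1⟩ := ell_vecL_neg hlam hs
    -- Along `vecL (-s)` the form `ell s` is constant and `ell (-s)` grows at unit speed, so the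
    -- derivative of `G` is the slope `b`.
    have hline : HasDerivAt (fun t : ℝ => x + t • vecL (-s) lam) (vecL (-s) lam) 0 := by
      simpa using ((hasDerivAt_id (0 : ℝ)).smul_const (vecL (-s) lam)).const_add x
    have h1 : HasDerivAt (fun t : ℝ => G (x + t • vecL (-s) lam)) (fderiv ℝ G x (vecL (-s) lam)) 0 := by
      refine HasFDerivAt.comp_hasDerivAt (0 : ℝ) (l := G) ?_ hline
      simpa using (hGan x hx).differentiableAt.hasFDerivAt
    have h2 : (fun t : ℝ => G (x + t • vecL (-s) lam)) = fun t : ℝ =>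
        a (ell s lam x) + (ell (-s) lam x + t) • b (ell s lam x) := by
      funext t
      simp only [G, ell_add_smul, hu0, hu1, mul_zero, add_zero, mul_one]
    have h3 : HasDerivAt (fun t : ℝ => a (ell s lam x) + (ell (-s) lam x + t) • b (ell s lam x))
        (b (ell s lam x)) 0 := by
      simpa using (((hasDerivAt_id (0 : ℝ)).const_add (ell (-s) lam x)).smul_const
        (b (ell s lam x))).const_add (a (ell s lam x))
    rw [h2] at h1
    rw [h1.unique h3]
    exact ⟨_, hbre _ (hmem x hx), Complex.ext rfl (hbim _ (hmem x hx))⟩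

/-! ### Assembly of the deformation -/

/-- The point of `ℂ²` with prescribed values of `ellC 1` and `ellC (-1)`. -/
def recon (lam : ℝ) (P Q : ℂ) : ℂ × ℂ :=
  ((lam / 2 : ℂ) * (P - Q), ((Real.sqrt (1 - lam ^ 2) : ℂ) / 2) * (P + Q))

theorem ellC_recon {lam : ℝ} (hlam : lam ∈ Ioo (0 : ℝ) 1) (P Q : ℂ) :
    ellC 1 lam (recon lam P Q) = P ∧ ellC (-1) lam (recon lam P Q) = Q := by
  have h1 : (lam : ℂ) ≠ 0 := by exact_mod_cast hlam.1.ne'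
  have h2 : (Real.sqrt (1 - lam ^ 2) : ℂ) ≠ 0 := by exact_mod_cast (sqrt_pos_of_mem hlam).ne'
  constructor <;> simp only [ellC, recon] <;> push_cast <;> field_simp <;> ring

theorem recon_ellC {lam : ℝ} (hlam : lam ∈ Ioo (0 : ℝ) 1) (w : ℂ × ℂ) :
    recon lam (ellC 1 lam w) (ellC (-1) lam w) = w := by
  have h1 : (lam : ℂ) ≠ 0 := by exact_mod_cast hlam.1.ne'
  have h2 : (Real.sqrt (1 - lam ^ 2) : ℂ) ≠ 0 := by exact_mod_cast (sqrt_pos_of_mem hlam).ne'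
  refine Prod.ext ?_ ?_ <;> simp only [ellC, recon] <;> push_cast <;> field_simp <;> ring

theorem ellC_toC2 (s lam : ℝ) (x : ℝ × ℝ) : ellC s lam (toC2 x) = (ell s lam x : ℂ) := by
  simp only [ellC, toC2, ell]
  push_cast
  ring

theorem analyticAt_evalSeries_apply {E : Type*} [NormedAddCommGroup E] [NormedSpace ℝ E]
    {K : ℝ} (hK : 0 < K) {ζ : E → ℂ} {G : E → BSeq} {x : E} (hζ : AnalyticAt ℝ ζ x)
    (hx : ‖ζ x‖ < 1 / K) (hG : AnalyticAt ℝ G x) :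
    AnalyticAt ℝ (fun x => evalSeries K (ζ x) (G x)) x := by
  have h1 : AnalyticAt ℂ (fun p : ℂ × BSeq => evalSeries K p.1 p.2) (ζ x, G x) := by
    have h2 : AnalyticAt ℂ (fun p : ℂ × BSeq => evalSeries K p.1) (ζ x, G x) :=
      AnalyticAt.comp (g := evalSeries K) (f := fun p : ℂ × BSeq => p.1)
        (analyticOnNhd_evalSeries hK _ (by simpa using hx)) analyticAt_fst
    exact AnalyticAt.comp (g := fun q : (BSeq →L[ℂ] ℂ) × BSeq => q.1 q.2)
      (f := fun p : ℂ × BSeq => (evalSeries K p.1, p.2))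
      ((ContinuousLinearMap.id ℂ (BSeq →L[ℂ] ℂ)).analyticAt_bilinear _)
      (h2.prod analyticAt_snd)
  exact AnalyticAt.comp (g := fun p : ℂ × BSeq => evalSeries K p.1 p.2)
    (f := fun x => (ζ x, G x)) h1.restrictScalars (hζ.prod hG)

/-- Periodicity of the coefficient comes from that of `X ∘ z` and `z'`, because `z'` does not
vanish. -/
theorem IsEscapeField.exists_coeff {Ω : Set (ℝ × ℝ)} {z : ℝ → ℝ × ℝ} {lam : ℝ}
    {X : ℝ × ℝ → ℝ × ℝ} (hX : IsEscapeField Ω z lam X) (hz : IsDirectParametrization Ω z) :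
    ∃ h : ℝ → ℝ, (∀ θ, AnalyticAt ℝ h θ) ∧ (∀ θ, X (z θ) = h θ • deriv z θ) ∧
      Function.Periodic h 1 := by
  obtain ⟨h, hh, hXh⟩ := hX.analytic
  refine ⟨h, hh, hXh, fun θ => smul_left_injective ℝ (hz.deriv_ne_zero θ) ?_⟩
  have hd : deriv z (θ + 1) = deriv z θ := by
    rw [← deriv_comp_add_const]
    exact congrArg (fun g => deriv g θ) (funext hz.periodic)
  have h1 := hXh (θ + 1)
  rw [hz.periodic θ, hd, hXh θ] at h1
  exact h1.symm

/-- The complex-time flow, given by the Lie series of the coordinates of `z`. -/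
theorem isComplexTimeFlow_lieSeq {Ω : Set (ℝ × ℝ)} {z : ℝ → ℝ × ℝ}
    (hz : IsDirectParametrization Ω z) {X : ℝ × ℝ → ℝ × ℝ} {h : ℝ → ℝ}
    (hh : ∀ θ, AnalyticAt ℝ h θ) (hXh : ∀ θ, X (z θ) = h θ • deriv z θ)
    (ph : Function.Periodic h 1) {K : ℝ} (hK : 0 < K) {S₁ S₂ : ℝ → BSeq}
    (hS₁ : ∀ u : ℝ → ℝ, (∀ t, HasDerivAt u (h (u t)) t) → ∀ t : ℝ, |t| < 1 / K →
      evalSeries K t (S₁ (u 0)) = ((z (u t)).1 : ℂ))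
    (hS₂ : ∀ u : ℝ → ℝ, (∀ t, HasDerivAt u (h (u t)) t) → ∀ t : ℝ, |t| < 1 / K →
      evalSeries K t (S₂ (u 0)) = ((z (u t)).2 : ℂ)) :
    IsComplexTimeFlow (frontier Ω) X (1 / K) fun ζ x =>
      (evalSeries K ζ (S₁ (Function.invFun z x)), evalSeries K ζ (S₂ (Function.invFun z x))) := by
  choose u hu0 hu using exists_global_flow hh ph
  have hinv : ∀ x ∈ frontier Ω, z (Function.invFun z x) = x := fun x hx => by
    rw [← hz.range_eq] at hx
    exact Function.invFun_eq hx
  have hd : ∀ c : BSeq, DifferentiableOn ℂ (fun ζ => evalSeries K ζ c) (Metric.ball 0 (1 / K)) :=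
    fun c => (analyticOnNhd_evalSeries hK).differentiableOn.clm_apply (differentiableOn_const c)
  refine ⟨fun x _ => (hd _).prodMk (hd _), fun t x => z (u (Function.invFun z x) t),
    fun x hx => ⟨by simp only [hu0, hinv x hx], fun t => ⟨?_, ?_⟩⟩, fun x hx t ht => ?_⟩
  · rw [← hz.range_eq]; exact mem_range_self _
  · rw [hXh]
    exact HasDerivAt.scomp t (hz.analytic _).differentiableAt.hasDerivAt (hu _ t)
  · have ht' : |t| < 1 / K := abs_lt.2 ht
    have h1 := hS₁ _ (hu (Function.invFun z x)) t ht'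
    have h2 := hS₂ _ (hu (Function.invFun z x)) t ht'
    rw [hu0] at h1 h2
    exact Prod.ext h1 h2

/-- The deformation of the domain assembled from its two components. -/
def deformation (lam K : ℝ) (G₁ G₂ : ℝ × ℝ → BSeq) (p : ℝ × (ℝ × ℝ)) : ℂ × ℂ :=
  recon lam (evalSeries K (Complex.I * p.1) (G₁ p.2)) (evalSeries K (Complex.I * p.1) (G₂ p.2))

theorem hasDerivAt_evalSeries_I {K : ℝ} (hK : 0 < K) (c : BSeq) :
    HasDerivAt (fun τ : ℝ => evalSeries K (Complex.I * τ) c) (Complex.I * (K * c 1)) 0 := by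
  have h1 : HasDerivAt (fun ζ : ℂ => evalSeries K (Complex.I * ζ)) (Complex.I • ((K : ℂ) • coord 1))
      ((0 : ℝ) : ℂ) := by
    have h0 : HasDerivAt (fun ζ : ℂ => Complex.I * ζ) Complex.I ((0 : ℝ) : ℂ) := by
      simpa using (hasDerivAt_id ((0 : ℝ) : ℂ)).const_mul Complex.I
    refine HasDerivAt.scomp ((0 : ℝ) : ℂ) (g₁ := evalSeries K) (h := fun ζ => Complex.I * ζ) ?_ h0
    simpa using hasDerivAt_evalSeries_zero hK
  have h2 := (h1.clm_apply (hasDerivAt_const ((0 : ℝ) : ℂ) c)).comp_ofReal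
  simpa using h2

/-- For fixed `τ`, evaluation is linear and commutes with the derivative in space; the derivative in
`τ` at `0` then selects the coefficient of order one. -/
theorem mixedDeriv_deformation {lam K : ℝ} (hK : 0 < K) {G₁ G₂ : ℝ × ℝ → BSeq} {x : ℝ × ℝ}
    (h₁ : DifferentiableAt ℝ G₁ x) (h₂ : DifferentiableAt ℝ G₂ x) (L : ℝ × ℝ) :
    mixedDeriv (deformation lam K G₁ G₂) L x =
      recon lam (Complex.I * (K * (fderiv ℝ G₁ x L) 1)) (Complex.I * (K * (fderiv ℝ G₂ x L) 1)) := by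
  have hfd : ∀ τ : ℝ, fderiv ℝ (fun y : ℝ × ℝ => deformation lam K G₁ G₂ (τ, y)) x L =
      recon lam (evalSeries K (Complex.I * τ) (fderiv ℝ G₁ x L))
        (evalSeries K (Complex.I * τ) (fderiv ℝ G₂ x L)) := fun τ => by
    have e : ∀ {G : ℝ × ℝ → BSeq}, DifferentiableAt ℝ G x →
        HasFDerivAt (fun y => evalSeries K (Complex.I * τ) (G y))
          (((evalSeries K (Complex.I * τ)).restrictScalars ℝ).comp (fderiv ℝ G x)) x := fun hG =>
      ((evalSeries K (Complex.I * τ)).restrictScalars ℝ).hasFDerivAt.comp x hG.hasFDerivAt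
    have e1 := ((e h₁).sub (e h₂)).const_mul (lam / 2 : ℂ)
    have e2 := ((e h₁).add (e h₂)).const_mul ((Real.sqrt (1 - lam ^ 2) : ℂ) / 2)
    have e3 := (e1.prodMk e2).fderiv
    have e4 := congrArg (fun T : ℝ × ℝ →L[ℝ] ℂ × ℂ => T L) e3
    exact e4
  unfold mixedDeriv
  simp only [hfd]
  have d1 := hasDerivAt_evalSeries_I hK (fderiv ℝ G₁ x L)
  have d2 := hasDerivAt_evalSeries_I hK (fderiv ℝ G₂ x L)
  exact (((d1.sub d2).const_mul (lam / 2 : ℂ)).prodMk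
    ((d1.add d2).const_mul ((Real.sqrt (1 - lam ^ 2) : ℂ) / 2))).deriv

end InternalWaves

end

theorem proposition2p6
    (Ω : Set (ℝ × ℝ)) (hΩ_open : IsOpen Ω) (hΩ_bdd : Bornology.IsBounded Ω)
    (hΩ_an : InternalWaves.HasAnalyticBoundary Ω)
    (z : ℝ → ℝ × ℝ) (hz : InternalWaves.IsDirectParametrization Ω z)
    (lam : ℝ) (hlam : lam ∈ Set.Ioo (0 : ℝ) 1)
    (hsimple : InternalWaves.IsLambdaSimple z lam)
    (X : ℝ × ℝ → ℝ × ℝ) (hX : InternalWaves.IsEscapeField Ω z lam X) :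
    ∃ τ₀ : ℝ, 0 < τ₀ ∧
      ∃ Ψ : ℂ → ℝ × ℝ → ℂ × ℂ, InternalWaves.IsComplexTimeFlow (frontier Ω) X τ₀ Ψ ∧
      ∃ Ξ : ℝ × (ℝ × ℝ) → ℂ × ℂ,
        -- real-analytic on a neighbourhood of the product with the closed domain
        AnalyticOnNhd ℝ Ξ (Set.Ioo (-τ₀) τ₀ ×ˢ closure Ω) ∧
        -- extends the deformation of the boundary
        (∀ τ ∈ Set.Ioo (-τ₀) τ₀, ∀ x ∈ frontier Ω,
          Ξ (τ, x) = Ψ (Complex.I * (τ : ℂ)) x) ∧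
        (∀ x ∈ closure Ω, Ξ (0, x) = InternalWaves.toC2 x) ∧
        (∀ x ∈ closure Ω, ∀ s ∈ ({1, -1} : Set ℝ), ∃ r : ℝ, 0 < r ∧
          InternalWaves.ellC s lam
            (InternalWaves.mixedDeriv Ξ (InternalWaves.vecL (-s) lam) x)
              = Complex.I * (r : ℂ)) := by
  open InternalWaves in
  obtain ⟨h, hh, hXh, ph⟩ := hX.exists_coeff hz
  have az₁ : ∀ θ, AnalyticAt ℝ (fun t => (z t).1) θ := fun θ =>
    AnalyticAt.comp (g := Prod.fst) (f := z) analyticAt_fst (hz.analytic θ)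
  have az₂ : ∀ θ, AnalyticAt ℝ (fun t => (z t).2) θ := fun θ =>
    AnalyticAt.comp (g := Prod.snd) (f := z) analyticAt_snd (hz.analytic θ)
  have pz₁ : Function.Periodic (fun t => (z t).1) 1 := fun t => by simp only [hz.periodic t]
  have pz₂ : Function.Periodic (fun t => (z t).2) 1 := fun t => by simp only [hz.periodic t]
  obtain ⟨K₁, hK₁, H₁⟩ := exists_lieSeq hh az₁ ph pz₁
  obtain ⟨K₂, hK₂, H₂⟩ := exists_lieSeq hh az₂ ph pz₂
  -- A common scale for both coordinates, so that their sequences can be combined linearly; `1 / K`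
  -- is the time of existence.
  set K := max K₁ K₂ with hKdef
  have hK : 0 < K := lt_max_of_lt_left hK₁
  obtain ⟨co₁, an₁, pe₁⟩ := H₁ K (le_max_left _ _)
  obtain ⟨co₂, an₂, pe₂⟩ := H₂ K (le_max_right _ _)
  set S₁ := lieSeq h (fun t => (z t).1) K with hS₁
  set S₂ := lieSeq h (fun t => (z t).2) K with hS₂
  have hflow : IsComplexTimeFlow (frontier Ω) X (1 / K) fun ζ x =>
      (evalSeries K ζ (S₁ (Function.invFun z x)), evalSeries K ζ (S₂ (Function.invFun z x))) :=
    isComplexTimeFlow_lieSeq hz hh hXh ph hK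
      (fun u hu t ht => evalSeries_lieSeq hh az₁ hK co₁ an₁ pe₁ hu ht)
      (fun u hu t ht => evalSeries_lieSeq hh az₂ hK co₂ an₂ pe₂ hu ht)
  set ρ := Real.sqrt (1 - lam ^ 2) with hρ
  -- The coefficients of `ellC s` of the flow, by linearity from those of the two coordinates.
  let F : ℝ → ℝ → BSeq := fun s θ => ((s / lam : ℝ) : ℂ) • S₁ θ + ((1 / ρ : ℝ) : ℂ) • S₂ θ
  have hFan : ∀ s θ, AnalyticAt ℝ (F s) θ := fun s θ => by
    have e : ∀ (c : ℂ) {f : ℝ → BSeq}, AnalyticAt ℝ f θ → AnalyticAt ℝ (fun θ => c • f θ) θ :=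
      fun c f hf => AnalyticAt.comp (f := f) (g := fun v : BSeq => c • v)
        (((c • ContinuousLinearMap.id ℂ BSeq).restrictScalars ℝ).analyticAt _) hf
    exact (e _ (an₁ θ)).add (e _ (an₂ θ))
  have hFp : ∀ s, Function.Periodic (F s) 1 := fun s θ => by simp only [F, pe₁ θ, pe₂ θ]
  have hFc : ∀ s θ n, F s θ n = ((s / lam : ℝ) : ℂ) * S₁ θ n + ((1 / ρ : ℝ) : ℂ) * S₂ θ n :=
    fun s θ n => rfl
  have hKc : (K : ℂ) ≠ 0 := by exact_mod_cast hK.ne'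
  have hF0 : ∀ s θ, F s θ 0 = (ell s lam (z θ) : ℂ) := fun s θ => by
    rw [hFc, co₁, co₂, ← ellL_apply]
    simp [lieIter, ellL, hρ]
  have hF1 : ∀ s θ, K * F s θ 1 = ((h θ * deriv (fun t => ell s lam (z t)) θ : ℝ) : ℂ) :=
    fun s θ => by
    have d1 := (az₁ θ).differentiableAt.hasDerivAt
    have d2 := (az₂ θ).differentiableAt.hasDerivAt
    have d3 : HasDerivAt (fun t => ell s lam (z t))
        ((s / lam) * deriv (fun t => (z t).1) θ + (1 / ρ) * deriv (fun t => (z t).2) θ) θ := by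
      refine ((d1.const_mul (s / lam)).add (d2.const_mul (1 / ρ))).congr_of_eventuallyEq
        (Filter.Eventually.of_forall fun t => (ellL_apply s lam (z t)).symm.trans ?_)
      simp [ellL, hρ]
    rw [d3.deriv, hFc, co₁, co₂]
    simp only [lieIter, Nat.factorial_one, pow_one, Nat.cast_one, one_mul]
    push_cast
    field_simp
  have hext : ∀ s : ℝ, s = 1 ∨ s = -1 → _ := fun s hs =>
    exists_component_extension hΩ_open hΩ_bdd hΩ_an hz hlam hsimple hX hh hXh hs
      (hFan s) (hFp s) (hF0 s) (hF1 s)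
  obtain ⟨G₁, aG₁, bG₁, cG₁, dG₁⟩ := hext 1 (Or.inl rfl)
  obtain ⟨G₂, aG₂, bG₂, cG₂, dG₂⟩ := hext (-1) (Or.inr rfl)
  refine ⟨1 / K, by positivity, _, hflow, deformation lam K G₁ G₂, ?_, ?_, ?_, ?_⟩
  · rintro ⟨τ, x⟩ ⟨hτ, hx⟩
    have hI : AnalyticAt ℝ (fun p : ℝ × (ℝ × ℝ) => Complex.I * (p.1 : ℂ)) (τ, x) :=
      analyticAt_const.mul (AnalyticAt.comp (g := fun t : ℝ => (t : ℂ))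
        (f := fun p : ℝ × (ℝ × ℝ) => p.1) (Complex.ofRealCLM.analyticAt τ) analyticAt_fst)
    have hn : ‖Complex.I * (τ : ℂ)‖ < 1 / K := by
      rw [norm_mul, Complex.norm_I, one_mul, Complex.norm_real]
      exact abs_lt.2 hτ
    have e : ∀ {G : ℝ × ℝ → BSeq}, AnalyticAt ℝ G x →
        AnalyticAt ℝ (fun p : ℝ × (ℝ × ℝ) => evalSeries K (Complex.I * p.1) (G p.2)) (τ, x) :=
      fun {G} hG => analyticAt_evalSeries_apply hK hI hn
        (AnalyticAt.comp (g := G) (f := Prod.snd) hG analyticAt_snd)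
    exact (analyticAt_const.mul ((e (aG₁ x hx)).sub (e (aG₂ x hx)))).prod
      (analyticAt_const.mul ((e (aG₁ x hx)).add (e (aG₂ x hx))))
  · intro τ _ x hx
    rw [← hz.range_eq] at hx
    have hinv : z (Function.invFun z x) = x := Function.invFun_eq hx
    have hval : ∀ s, evalSeries K (Complex.I * τ) (F s (Function.invFun z x)) =
        ellC s lam (evalSeries K (Complex.I * τ) (S₁ (Function.invFun z x)),
          evalSeries K (Complex.I * τ) (S₂ (Function.invFun z x))) := fun s => by
      simp only [F, map_add, map_smul, smul_eq_mul, ellC, hρ]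
      push_cast
      ring
    have e1 := bG₁ (Function.invFun z x)
    have e2 := bG₂ (Function.invFun z x)
    rw [hinv] at e1 e2
    simp only [deformation]
    rw [e1, e2, hval, hval, recon_ellC hlam]
  · intro x hx
    simp only [deformation, Complex.ofReal_zero, mul_zero, evalSeries_zero hK]
    rw [cG₁ x hx, cG₂ x hx, ← ellC_toC2, ← ellC_toC2, recon_ellC hlam]
  · intro x hx s hs
    rw [mixedDeriv_deformation hK (aG₁ x hx).differentiableAt (aG₂ x hx).differentiableAt]
    rcases hs with rfl | rfl
    · obtain ⟨r, hr, hr'⟩ := dG₁ x hx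
      exact ⟨r, hr, by rw [(ellC_recon hlam _ _).1, hr']⟩
    · obtain ⟨r, hr, hr'⟩ := dG₂ x hx
      exact ⟨r, hr, by rw [(ellC_recon hlam _ _).2, hr']⟩
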